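/- Consider the class of equations $$u_t+u^n u_x+\beta(t)u_{xxxxx}=0,\qquad(\ast)$$ where $n\ge 2$ is an integer and $\beta$ is a smooth nonvanishing real function on an open interval. A point transformation is a diffeomorphism $(t,x,u)\mapsto(\tilde t,\tilde x,\tilde u)$ from a connected open set of $\mathbb R^3$ onto an open set. An admissible transformation of $(\ast)$ is a triple consisting of two equations of the class and a point transformation, of arbitrary form $\tilde t=T(t,x,u)$, $\tilde x=X(t,x,u)$, $\tilde u=U(t,x,u)$, whose prolongation to fifth-order jets maps the manifold defined by the first equation in the jet space to the manifold defined by the second one. A (local) generalized equivalence transformation is a point transformation of the variables $(t,x,u,\beta)$ on a connected open set with $\beta\ne0$, which may also depend on $n$, such that it maps every equation of the class to an equation of the class, inducing an admissible transformation between them. For each $n\geq 2$ the generalized equivalence group $G^\sim_0$ of the class $(\ast)$ consists of the (restrictions to connected open sets of the) transformations $$\tilde t=\delta_3t+\delta_4,\quad \tilde x=\delta_1x+\delta_2,\quad \tilde u=\kappa u,\quad \tilde\beta(\tilde t)=\frac{\delta_1^5}{\delta_3}\beta(t),\quad \tilde n=n,$$ where $\delta_1,\dots,\delta_4$ are arbitrary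 real constants with $\delta_1\delta_3\neq0$ for which $\delta_1/\delta_3$ has a real $n$-th root, and $\kappa$ is a real $n$-th root of $\delta_1/\delta_3$, $\kappa^n=\delta_1/\delta_3$. (So $\delta_1\delta_3>0$ and $\kappa=\pm(\delta_1/\delta_3)^{1/n}$ if $n$ is even, and $\kappa$ is the unique real $n$-th root of $\delta_1/\delta_3$ if $n$ is odd.) The transformations of this group that preserve positivity of $u$ are exactly those with $\delta_1\delta_3>0$ and $\tilde u=(\delta_1/\delta_3)^{1/n}u$ with the positive root. The entire set of admissible transformations of the class $(\ast)$ is generated by the transformations from $G^\sim_0$: a point transformation on a connected open set maps one equation of the class to another one if and only if the two exponents are equal and the transformation is the restriction of the $(t,x,u)$-part of an element of $G^\sim_0$ which maps the first coefficient to the second one on the corresponding values of $t$. -/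

import Mathlib

open scoped ContDiff Topology

/-- An equation `u_t + u ^ n * u_x + β(t) * u_xxxxx = 0` of the class: an integer exponent `n ≥ 2`
and a smooth nonvanishing coefficient `β` on a nonempty open interval `I` of the `t`-axis. -/
structure FKdV where
  n : ℕ
  two_le_n : 2 ≤ n
  I : Set ℝ
  isOpen_I : IsOpen I
  isConnected_I : IsConnected I
  β : ℝ → ℝ
  smooth_β : ContDiffOn ℝ ∞ β I
  β_ne_zero : ∀ t ∈ I, β t ≠ 0

/-- The equation holds for the function `u = u(t, x)` at the single point `q = (t, x)`,
that is, the fifth-order jet of `u` at `q` lies on the manifold defined by the equation. -/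
def FKdV.HoldsAt (e : FKdV) (u : ℝ × ℝ → ℝ) (q : ℝ × ℝ) : Prop :=
  deriv (fun s => u (s, q.2)) q.1 + u q ^ e.n * deriv (fun y => u (q.1, y)) q.2
    + e.β q.1 * iteratedDeriv 5 (fun y => u (q.1, y)) q.2 = 0

/-- A smooth transformation of the open connected set `Ω` which is injective with an invertible
derivative at every point, i.e. a diffeomorphism of `Ω` onto an open set. -/
def IsSmoothTransformation {E : Type*} [NormedAddCommGroup E] [NormedSpace ℝ E]
    (Ω : Set E) (Φ : E → E) : Prop :=
  IsOpen Ω ∧ IsConnected Ω ∧ ContDiffOn ℝ ∞ Φ Ω ∧ Set.InjOn Φ Ω ∧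
    ∀ p ∈ Ω, (fderiv ℝ Φ p).IsInvertible

/-- For a point transformation `Φ : (t, x, u) ↦ (T, X, U)` and a function `u`, the map
`(t, x) ↦ (T(t, x, u(t, x)), X(t, x, u(t, x)))`. -/
def baseMap (Φ : ℝ × ℝ × ℝ → ℝ × ℝ × ℝ) (u : ℝ × ℝ → ℝ) (q : ℝ × ℝ) : ℝ × ℝ :=
  ((Φ (q.1, q.2, u q)).1, (Φ (q.1, q.2, u q)).2.1)

/-- `v` is the transform of `u` by `Φ` near the point `q`: the map of the independent variables
is nondegenerate at `q`, and `Φ` maps the graph of `u` over a neighbourhood of `q`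
into the graph of `v`. -/
def IsTransformAt (Φ : ℝ × ℝ × ℝ → ℝ × ℝ × ℝ) (u v : ℝ × ℝ → ℝ) (q : ℝ × ℝ) : Prop :=
  (fderiv ℝ (baseMap Φ u) q).IsInvertible ∧
    ∀ᶠ r in 𝓝 q, v (baseMap Φ u r) = (Φ (r.1, r.2, u r)).2.2

/-- `(e, e', Φ)` is an admissible transformation: `Φ` is a (local) point transformation
`(t, x, u) ↦ (T(t, x, u), X(t, x, u), U(t, x, u))` with domain `Ω`, lying over the domains of the
two equations, and the prolongation of `Φ` to fifth-order jets carries the manifold defined by `e`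
to the one defined by `e'`.  The smooth functions `u`, `v` represent a jet and its image under
the prolongation; the jet is taken at one point and `u` need not be a solution elsewhere. -/
def IsAdmissible (e e' : FKdV) (Ω : Set (ℝ × ℝ × ℝ)) (Φ : ℝ × ℝ × ℝ → ℝ × ℝ × ℝ) : Prop :=
  IsSmoothTransformation Ω Φ ∧
  (∀ p ∈ Ω, p.1 ∈ e.I ∧ (Φ p).1 ∈ e'.I) ∧
  ∀ u v : ℝ × ℝ → ℝ, ContDiff ℝ ∞ u → ContDiff ℝ ∞ v → ∀ q : ℝ × ℝ,
    (q.1, q.2, u q) ∈ Ω → IsTransformAt Φ u v q →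
      (e.HoldsAt u q ↔ e'.HoldsAt v (baseMap Φ u q))

/-- The map of the variables `(t, x, u)` that a transformation `Ψ` of the extended space
`(t, x, u, b)` induces for a given value `β` of the coefficient (`b` stands for `β(t)`). -/
def inducedMap (Ψ : ℝ × ℝ × ℝ × ℝ → ℝ × ℝ × ℝ × ℝ) (β : ℝ → ℝ) (p : ℝ × ℝ × ℝ) : ℝ × ℝ × ℝ :=
  ((Ψ (p.1, p.2.1, p.2.2, β p.1)).1, (Ψ (p.1, p.2.1, p.2.2, β p.1)).2.1,
    (Ψ (p.1, p.2.1, p.2.2, β p.1)).2.2.1)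

/-- For the value `n` of the exponent, `Ψ` (with `n` replaced by `n'`) acts as a (local)
generalized equivalence transformation of the class: `Ψ` is a point transformation of the space
`(t, x, u, b)`, all of whose components may depend on the coefficient value `b`, and it maps
every equation of the class with exponent `n` to an equation of the class with exponent `n'`
by an admissible transformation, the last component giving the new coefficient. -/
def IsEquivalenceTransformation (n n' : ℕ) (Ω : Set (ℝ × ℝ × ℝ × ℝ))
    (Ψ : ℝ × ℝ × ℝ × ℝ → ℝ × ℝ × ℝ × ℝ) : Prop :=
  IsSmoothTransformation Ω Ψ ∧
  ∀ e : FKdV, e.n = n → ∀ W : Set (ℝ × ℝ × ℝ), IsOpen W → IsConnected W →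
    (∀ p ∈ W, p.1 ∈ e.I ∧ (p.1, p.2.1, p.2.2, e.β p.1) ∈ Ω) →
      ∃ e' : FKdV, e'.n = n' ∧ IsAdmissible e e' W (inducedMap Ψ e.β) ∧
        ∀ p ∈ W, e'.β (inducedMap Ψ e.β p).1 = (Ψ (p.1, p.2.1, p.2.2, e.β p.1)).2.2.2

/-- The group of the transformations `t' = δ₃ t + δ₄`, `x' = δ₁ x + δ₂`, `u' = κ u`,
`b' = δ₁ ^ 5 b / δ₃` with `κ` a real `n`-th root of `δ₁ / δ₃`. -/
def groupG (n : ℕ) : Subgroup (Equiv.Perm (ℝ × ℝ × ℝ × ℝ)) where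
  carrier := {g | ∃ δ₁ δ₂ δ₃ δ₄ κ : ℝ, δ₁ ≠ 0 ∧ δ₃ ≠ 0 ∧ κ ^ n = δ₁ / δ₃ ∧
    ∀ t x u b : ℝ, g (t, x, u, b) = (δ₃ * t + δ₄, δ₁ * x + δ₂, κ * u, δ₁ ^ 5 / δ₃ * b)}
  one_mem' := ⟨1, 0, 1, 0, 1, by simp, by simp, by simp, by simp⟩
  mul_mem' := by
    rintro g h ⟨a₁, a₂, a₃, a₄, k, ha₁, ha₃, hk, hg⟩ ⟨b₁, b₂, b₃, b₄, l, hb₁, hb₃, hl, hh⟩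
    refine ⟨a₁ * b₁, a₁ * b₂ + a₂, a₃ * b₃, a₃ * b₄ + a₄, k * l, mul_ne_zero ha₁ hb₁,
      mul_ne_zero ha₃ hb₃, ?_, ?_⟩
    · rw [mul_pow, hk, hl]
      field_simp
    · intro t x u b
      rw [Equiv.Perm.mul_apply, hh, hg]
      refine Prod.ext ?_ (Prod.ext ?_ (Prod.ext ?_ ?_)) <;> simp only <;> field_simp <;> ring
  inv_mem' := by
    rintro g ⟨a₁, a₂, a₃, a₄, k, ha₁, ha₃, hk, hg⟩
    have hk0 : k ≠ 0 := by
      rintro rfl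
      have h := g.injective ((hg 0 0 1 0).trans ((by simp : _ = _).trans (hg 0 0 0 0).symm))
      simp at h
    refine ⟨a₁⁻¹, -a₂ / a₁, a₃⁻¹, -a₄ / a₃, k⁻¹, inv_ne_zero ha₁, inv_ne_zero ha₃, ?_, ?_⟩
    · rw [inv_pow, hk]
      field_simp
    · intro t x u b
      rw [Equiv.Perm.inv_eq_iff_eq, hg]
      refine Prod.ext ?_ (Prod.ext ?_ (Prod.ext ?_ ?_)) <;> simp only <;> field_simp <;> ring

/-! Write `T, X, U` for the components of the transformation and `D_x = ∂_x + u_x ∂_u`. Since only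
jets at one point matter, the transformation can be tested on pairs of polynomials with the same
value at a point, both satisfying the source equation there, whose difference is one or two
monomials. To leading order the transforms differ by a nonzero multiple of that difference written
in the new variables. Subtracting the two target equations removes the nonlinear term and leaves a
determining equation. This replaces the prolongation formulas (`IsAdmissible.perturbation`).

The difference `(t - t₀)^5` is invisible to the source equation, but creates a fifth derivative in
the new space variable unless `D_x T = 0`; hence `T = T(t)`. The difference `-β (t - t₀) + (x -
x₀)^5 / 120` gives `β' T_t = β (D_x X)^5`. The left side is free of `u_x`, so `X_u = 0`, and `X_x`
depends on `t` only.

With `T` and `X` so restricted, the target equation can be pulled back explicitly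
(`holdsAt_transform_iff`). The difference `(x - x₀)^4` then gives `D_x U_u = 0`, so locally `U =
g(t) u + f(t, x)`. Comparing `u_x = 0` with `u_x = 1` gives `T_t U^n' = X_t + X_x u^n`, a polynomial
identity in `u`: it forces `n' = n`, `f = 0`, `X_t = 0` and `T_t g^n = X_x`. Constants solve the
equation, so `U_t = 0`. Thus `X_x`, `g` and finally `T_t` are locally constant, and connectedness
makes the parameters global (`IsAdmissible.exists_eq`).

An equivalence transformation restricts to an admissible one over each graph `b = β(t)`. Constant
coefficients give the form with parameters that might depend on `b`; a coefficient of slope one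
meets all these slices and forces common parameters. -/

/-! ### Invertibility criteria and gluing over connected sets -/

theorem ContinuousLinearMap.isInvertible_of_injective {E : Type*} [NormedAddCommGroup E]
    [NormedSpace ℝ E] [FiniteDimensional ℝ E] {L : E →L[ℝ] E} (h : Function.Injective L) :
    L.IsInvertible :=
  ⟨(LinearEquiv.ofInjectiveEndo (L : E →ₗ[ℝ] E) h).toContinuousLinearEquiv, by ext x; rfl⟩

theorem isInvertible_of_det_ne_zero {L : ℝ × ℝ →L[ℝ] ℝ × ℝ}
    (h : (L (1, 0)).1 * (L (0, 1)).2 - (L (1, 0)).2 * (L (0, 1)).1 ≠ 0) : L.IsInvertible := by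
  apply ContinuousLinearMap.isInvertible_of_injective
  rw [injective_iff_map_eq_zero]
  rintro ⟨a, b⟩ hab
  have e : L (a, b) = a • L (1, 0) + b • L (0, 1) := by
    rw [← map_smul, ← map_smul, ← map_add]; simp
  rw [e] at hab
  have h1 := congrArg Prod.fst hab
  have h2 := congrArg Prod.snd hab
  simp only [Prod.fst_add, Prod.smul_fst, smul_eq_mul, Prod.fst_zero, Prod.snd_add,
    Prod.smul_snd, Prod.snd_zero] at h1 h2
  refine Prod.ext ?_ ?_
  · exact (mul_eq_zero.1 (by linear_combination (L (0, 1)).2 * h1 - (L (0, 1)).1 * h2 :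
      a * ((L (1, 0)).1 * (L (0, 1)).2 - (L (1, 0)).2 * (L (0, 1)).1) = 0)).resolve_right h
  · exact (mul_eq_zero.1 (by linear_combination (L (1, 0)).1 * h2 - (L (1, 0)).2 * h1 :
      b * ((L (1, 0)).1 * (L (0, 1)).2 - (L (1, 0)).2 * (L (0, 1)).1) = 0)).resolve_right h

/-- A function which is locally, near each point of a preconnected set, a member of a family,
the member being unique, is globally so. -/
theorem IsPreconnected.exists_forall_of_eventually {α ι : Type*} [TopologicalSpace α] {s : Set α}
    (hs : IsPreconnected s) (hne : s.Nonempty) (Q : ι → α → Prop)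
    (hex : ∀ x ∈ s, ∃ i, ∀ᶠ y in 𝓝 x, Q i y)
    (huniq : ∀ i j x, (∀ᶠ y in 𝓝 x, Q i y) → (∀ᶠ y in 𝓝 x, Q j y) → i = j) :
    ∃ i, ∀ x ∈ s, Q i x := by
  obtain ⟨x₀, hx₀⟩ := hne
  obtain ⟨i, hi⟩ := hex x₀ hx₀
  refine ⟨i, fun x hx => ?_⟩
  have hopen : ∀ j, IsOpen {x | ∀ᶠ y in 𝓝 x, Q j y} := fun j => isOpen_setOfPred_eventually_nhds
  have hsub : s ⊆ {x | ∀ᶠ y in 𝓝 x, Q i y} := by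
    -- The points where `i` works locally and those where some other index does are disjoint open
    -- sets covering `s`.
    refine IsPreconnected.subset_left_of_subset_union (hopen i)
      (isOpen_iUnion fun j => isOpen_iUnion fun _ : j ≠ i => hopen j) ?_ ?_ ⟨x₀, hx₀, hi⟩ hs
    · rw [Set.disjoint_left]
      intro x hx hx'
      simp only [Set.mem_iUnion] at hx'
      obtain ⟨j, hj, hjx⟩ := hx'
      exact hj (huniq j i x hjx hx)
    · intro x hx
      obtain ⟨j, hj⟩ := hex x hx
      by_cases hij : j = i
      · left; subst hij; exact hj
      · right
        simp only [Set.mem_iUnion]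
        exact ⟨j, hij, hj⟩
  exact (hsub hx : ∀ᶠ y in 𝓝 x, Q i y).self_of_nhds

/-! ### Derivatives read off from asymptotic expansions -/

/-- Induction on `k`: once the lower derivatives vanish, the Taylor polynomial is a single monomial
of degree `k`, which is `o((x - x₀)^k)` only if its coefficient is zero. -/
theorem iteratedDeriv_eq_zero_of_isLittleO {f : ℝ → ℝ} {x₀ : ℝ} {n : ℕ} (hf : ContDiffAt ℝ n f x₀)
    (h : f =o[𝓝 x₀] fun x => (x - x₀) ^ n) {k : ℕ} (hk : k ≤ n) : iteratedDeriv k f x₀ = 0 := by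
  induction k using Nat.strong_induction_on with
  | _ k ih =>
  obtain ⟨u, hu, hfu⟩ := (hf.of_le (by exact_mod_cast hk : (k : WithTop ℕ∞) ≤ n)).contDiffOn le_rfl
    (by simp)
  obtain ⟨ε, hε, hb⟩ := Metric.mem_nhds_iff.1 hu
  have hx : x₀ ∈ Metric.ball x₀ ε := Metric.mem_ball_self hε
  have ht := taylor_isLittleO (convex_ball x₀ ε) hx (hfu.mono hb)
  rw [Metric.isOpen_ball.nhdsWithin_eq hx] at ht
  have he : ∀ x, taylorWithinEval f k (Metric.ball x₀ ε) x₀ x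
      = ((k.factorial : ℝ)⁻¹ * iteratedDeriv k f x₀) * (x - x₀) ^ k := by
    intro x
    rw [taylor_within_apply, Finset.sum_range_succ, Finset.sum_eq_zero, zero_add,
      iteratedDerivWithin_of_isOpen Metric.isOpen_ball hx, smul_eq_mul]
    · ring
    · intro j hj
      rw [Finset.mem_range] at hj
      rw [iteratedDerivWithin_of_isOpen Metric.isOpen_ball hx, ih j hj (by omega), smul_zero]
  have hle : (fun x : ℝ => (x - x₀) ^ n) =O[𝓝 x₀] fun x => (x - x₀) ^ k := by
    have : ∀ x : ℝ, (x - x₀) ^ n = (x - x₀) ^ (n - k) * (x - x₀) ^ k := fun x => by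
      rw [← pow_add, Nat.sub_add_cancel hk]
    simp_rw [this]
    have hc : (fun x : ℝ => (x - x₀) ^ (n - k)) =O[𝓝 x₀] fun _ => (1 : ℝ) :=
      (by fun_prop : Continuous fun x : ℝ => (x - x₀) ^ (n - k)).continuousAt.isBigO_one ℝ
    simpa using hc.mul (Asymptotics.isBigO_refl (fun x : ℝ => (x - x₀) ^ k) _)
  have h3 := (h.trans_isBigO hle).sub ht
  simp only [sub_sub_cancel, he] at h3
  by_contra hne
  rw [Asymptotics.isLittleO_const_mul_left_iff (mul_ne_zero (by positivity) hne)] at h3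
  refine Asymptotics.isLittleO_irrefl ?_ h3
  rw [Filter.frequently_iff]
  intro U hU
  obtain ⟨δ, hδ, hbU⟩ := Metric.mem_nhds_iff.1 hU
  exact ⟨x₀ + δ / 2, hbU (by simp [abs_of_pos hδ, hδ]), by simp [hδ.ne']⟩

theorem iteratedDeriv_sub_const_pow (m k : ℕ) (x₀ x : ℝ) :
    iteratedDeriv k (fun y : ℝ => (y - x₀) ^ m) x = m.descFactorial k * (x - x₀) ^ (m - k) := by
  have := iteratedDeriv_comp_sub_const k (fun y : ℝ => y ^ m) x₀
  rw [this]
  simp only [iteratedDeriv_pow]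

/-- The quartic term is allowed because a perturbation by `(x - x₀)^4` produces one; it affects
neither of the two derivatives that enter the equation. -/
theorem iteratedDeriv_of_isLittleO {f : ℝ → ℝ} {x₀ α γ : ℝ} (hf : ContDiffAt ℝ 5 f x₀)
    (h : (fun x => f x - (α * (x - x₀) ^ 4 + γ * (x - x₀) ^ 5)) =o[𝓝 x₀] fun x => (x - x₀) ^ 5) :
    iteratedDeriv 5 f x₀ = 120 * γ ∧ deriv f x₀ = 0 := by
  have hp : ContDiff ℝ 5 (fun x : ℝ => α * (x - x₀) ^ 4 + γ * (x - x₀) ^ 5) := by fun_prop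
  have h4 : ∀ m : ℕ, ContDiff ℝ 5 (fun x : ℝ => (x - x₀) ^ m) := fun m => by fun_prop
  have key : ∀ k : ℕ, k ≤ 5 → iteratedDeriv k f x₀
      = α * iteratedDeriv k (fun x : ℝ => (x - x₀) ^ 4) x₀
        + γ * iteratedDeriv k (fun x : ℝ => (x - x₀) ^ 5) x₀ := by
    intro k hk
    have hk' : (k : WithTop ℕ∞) ≤ 5 := by exact_mod_cast hk
    have h0 := iteratedDeriv_eq_zero_of_isLittleO (n := 5) (hf.sub hp.contDiffAt) h hk
    have h1 := iteratedDeriv_sub (hf.of_le hk') (hp.contDiffAt.of_le hk' (x := x₀))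
    have h2 := iteratedDeriv_add (x := x₀)
      ((contDiff_const.mul (h4 4)).contDiffAt.of_le hk' : ContDiffAt ℝ k
        (fun x : ℝ => α * (x - x₀) ^ 4) x₀)
      ((contDiff_const.mul (h4 5)).contDiffAt.of_le hk' : ContDiffAt ℝ k
        (fun x : ℝ => γ * (x - x₀) ^ 5) x₀)
    rw [iteratedDeriv_const_mul_field, iteratedDeriv_const_mul_field] at h2
    rw [← h2, ← sub_eq_zero]
    exact h1.symm.trans h0
  refine ⟨?_, ?_⟩
  · rw [key 5 le_rfl, iteratedDeriv_sub_const_pow, iteratedDeriv_sub_const_pow]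
    norm_num [Nat.descFactorial]
    ring
  · rw [← iteratedDeriv_one, key 1 (by norm_num), iteratedDeriv_sub_const_pow,
      iteratedDeriv_sub_const_pow]
    norm_num [Nat.descFactorial]

theorem HasFDerivAt.deriv_fst {u : ℝ × ℝ → ℝ} {q : ℝ × ℝ} {l : ℝ × ℝ →L[ℝ] ℝ}
    (h : HasFDerivAt u l q) : HasDerivAt (fun s => u (s, q.2)) (l (1, 0)) q.1 := by
  have h1 : HasDerivAt (fun s : ℝ => (s, q.2)) ((1 : ℝ), (0 : ℝ)) q.1 :=
    (hasDerivAt_id q.1).prodMk (hasDerivAt_const _ _)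
  exact HasFDerivAt.comp_hasDerivAt (f := fun s : ℝ => (s, q.2)) q.1 h h1

theorem HasFDerivAt.deriv_snd {u : ℝ × ℝ → ℝ} {q : ℝ × ℝ} {l : ℝ × ℝ →L[ℝ] ℝ}
    (h : HasFDerivAt u l q) : HasDerivAt (fun y => u (q.1, y)) (l (0, 1)) q.2 := by
  have h1 : HasDerivAt (fun y : ℝ => (q.1, y)) ((0 : ℝ), (1 : ℝ)) q.2 :=
    (hasDerivAt_const _ _).prodMk (hasDerivAt_id q.2)
  exact HasFDerivAt.comp_hasDerivAt (f := fun y : ℝ => (q.1, y)) q.2 h h1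

/-! ### Polynomials representing jets -/

/-- A polynomial realizing prescribed values of the derivatives
`u`, `u_t`, `u_x`, `u_xxxx / 4!`, `u_xxxxx / 5!`, `u_ttttt / 5!` at `q`. -/
def jetPoly (q : ℝ × ℝ) (k α r δ γ η : ℝ) (p : ℝ × ℝ) : ℝ :=
  k + α * (p.1 - q.1) + r * (p.2 - q.2) + δ * (p.2 - q.2) ^ 4 + γ * (p.2 - q.2) ^ 5
    + η * (p.1 - q.1) ^ 5

section jetPoly
variable (q : ℝ × ℝ) (k α r δ γ η : ℝ)

theorem contDiff_jetPoly : ContDiff ℝ ∞ (jetPoly q k α r δ γ η) := by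
  unfold jetPoly; fun_prop

@[simp] theorem jetPoly_self : jetPoly q k α r δ γ η q = k := by simp [jetPoly]

theorem hasDerivAt_jetPoly_fst :
    HasDerivAt (fun s => jetPoly q k α r δ γ η (s, q.2)) α q.1 := by
  have h := (((hasDerivAt_id q.1).sub_const q.1).const_mul α).const_add k |>.add
    ((((hasDerivAt_id q.1).sub_const q.1).pow 5).const_mul η)
  exact (h.congr_deriv (by simp)).congr_of_eventuallyEq (.of_forall fun s => by simp [jetPoly])

theorem hasDerivAt_jetPoly_snd :
    HasDerivAt (fun y => jetPoly q k α r δ γ η (q.1, y)) r q.2 := by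
  have h := ((((hasDerivAt_id q.2).sub_const q.2).const_mul r).const_add k |>.add
    ((((hasDerivAt_id q.2).sub_const q.2).pow 4).const_mul δ)).add
    ((((hasDerivAt_id q.2).sub_const q.2).pow 5).const_mul γ)
  exact (h.congr_deriv (by simp)).congr_of_eventuallyEq (.of_forall fun s => by simp [jetPoly])

theorem fderiv_jetPoly_fst : fderiv ℝ (jetPoly q k α r δ γ η) q (1, 0) = α :=
  (((contDiff_jetPoly q k α r δ γ η).differentiable (by simp) q).hasFDerivAt.deriv_fst).unique
    (hasDerivAt_jetPoly_fst q k α r δ γ η)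

theorem fderiv_jetPoly_snd : fderiv ℝ (jetPoly q k α r δ γ η) q (0, 1) = r :=
  (((contDiff_jetPoly q k α r δ γ η).differentiable (by simp) q).hasFDerivAt.deriv_snd).unique
    (hasDerivAt_jetPoly_snd q k α r δ γ η)

theorem iteratedDeriv_jetPoly :
    iteratedDeriv 5 (fun y => jetPoly q k α r δ γ η (q.1, y)) q.2 = 120 * γ := by
  let P : Polynomial ℝ := Polynomial.C k + Polynomial.C r * (Polynomial.X - Polynomial.C q.2)
    + Polynomial.C δ * (Polynomial.X - Polynomial.C q.2) ^ 4
    + Polynomial.C γ * (Polynomial.X - Polynomial.C q.2) ^ 5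
  have hP : (fun y => jetPoly q k α r δ γ η (q.1, y)) = fun y => P.eval y := by
    funext y; simp [P, jetPoly]
  rw [hP, iteratedDeriv_eq_iterate]
  simp only [Function.iterate_succ, Function.iterate_zero, Function.comp, id,
    show ∀ R : Polynomial ℝ, deriv (fun y => R.eval y) = fun y => R.derivative.eval y from
      fun R => funext fun y => R.deriv]
  simp [P, Polynomial.derivative_pow, Polynomial.derivative_mul]
  ring

theorem holdsAt_jetPoly (e : FKdV) : e.HoldsAt (jetPoly q k α r δ γ η) q ↔
    α + k ^ e.n * r + e.β q.1 * (120 * γ) = 0 := by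
  rw [FKdV.HoldsAt, (hasDerivAt_jetPoly_fst q k α r δ γ η).deriv,
    (hasDerivAt_jetPoly_snd q k α r δ γ η).deriv, iteratedDeriv_jetPoly, jetPoly_self]

end jetPoly

/-! ### Transforms of functions under a point transformation -/

section transform
variable {Ω : Set (ℝ × ℝ × ℝ)} {Φ : ℝ × ℝ × ℝ → ℝ × ℝ × ℝ} {u v : ℝ × ℝ → ℝ} {q : ℝ × ℝ}

theorem contDiffAt_baseMap (hΦ : ContDiffAt ℝ ∞ Φ (q.1, q.2, u q)) (hu : ContDiffAt ℝ ∞ u q) :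
    ContDiffAt ℝ ∞ (baseMap Φ u) q := by
  have h : ContDiffAt ℝ ∞ (fun r : ℝ × ℝ => Φ (r.1, r.2, u r)) q :=
    ContDiffAt.comp q (f := fun r : ℝ × ℝ => (r.1, r.2, u r)) hΦ
      (contDiffAt_fst.prodMk (contDiffAt_snd.prodMk hu))
  exact h.fst.prodMk h.snd.fst

theorem hasFDerivAt_graph (hΦ : DifferentiableAt ℝ Φ (q.1, q.2, u q)) (hu : DifferentiableAt ℝ u q) :
    HasFDerivAt (fun r : ℝ × ℝ => Φ (r.1, r.2, u r)) ((fderiv ℝ Φ (q.1, q.2, u q)).comp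
      ((ContinuousLinearMap.fst ℝ ℝ ℝ).prod
        ((ContinuousLinearMap.snd ℝ ℝ ℝ).prod (fderiv ℝ u q)))) q :=
  HasFDerivAt.comp q (f := fun r : ℝ × ℝ => (r.1, r.2, u r)) hΦ.hasFDerivAt
    (hasFDerivAt_fst.prodMk (hasFDerivAt_snd.prodMk hu.hasFDerivAt))

theorem fderiv_baseMap_apply (hΦ : DifferentiableAt ℝ Φ (q.1, q.2, u q))
    (hu : DifferentiableAt ℝ u q) (d : ℝ × ℝ) : fderiv ℝ (baseMap Φ u) q d =
      ((fderiv ℝ Φ (q.1, q.2, u q) (d.1, d.2, fderiv ℝ u q d)).1,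
        (fderiv ℝ Φ (q.1, q.2, u q) (d.1, d.2, fderiv ℝ u q d)).2.1) := by
  have h := hasFDerivAt_graph hΦ hu
  have h' : HasFDerivAt (baseMap Φ u) _ q := h.fst.prodMk h.snd.fst
  rw [h'.fderiv]
  rfl

/-- The inverse function theorem gives the transform near the image point. A bump function extends
it to the whole plane, because admissibility is tested on globally smooth functions. -/
theorem exists_isTransformAt (hΩ : IsOpen Ω) (hΦ : ContDiffOn ℝ ∞ Φ Ω) (hu : ContDiff ℝ ∞ u)
    (hq : (q.1, q.2, u q) ∈ Ω) (hinv : (fderiv ℝ (baseMap Φ u) q).IsInvertible) :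
    ∃ v, ContDiff ℝ ∞ v ∧ IsTransformAt Φ u v q := by
  have hgr : Continuous fun r : ℝ × ℝ => (r.1, r.2, u r) :=
    continuous_fst.prodMk (continuous_snd.prodMk hu.continuous)
  have hΦ' : ∀ r : ℝ × ℝ, (r.1, r.2, u r) ∈ Ω → ContDiffAt ℝ ∞ Φ (r.1, r.2, u r) :=
    fun r hr => hΦ.contDiffAt (hΩ.mem_nhds hr)
  have hB : ∀ r : ℝ × ℝ, (r.1, r.2, u r) ∈ Ω → ContDiffAt ℝ ∞ (baseMap Φ u) r :=
    fun r hr => contDiffAt_baseMap (hΦ' r hr) hu.contDiffAt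
  obtain ⟨M, hM⟩ := hinv
  have hBq : HasFDerivAt (baseMap Φ u) (M : ℝ × ℝ →L[ℝ] ℝ × ℝ) q := by
    rw [hM]; exact ((hB q hq).differentiableAt (by simp)).hasFDerivAt
  set H := (hB q hq).toOpenPartialHomeomorph (baseMap Φ u) hBq (by simp) with hH
  have hHc : (H : ℝ × ℝ → ℝ × ℝ) = baseMap Φ u := rfl
  have hqs : q ∈ H.source := (hB q hq).mem_toOpenPartialHomeomorph_source hBq (by simp)
  have hsy : H.symm (baseMap Φ u q) = q := H.left_inv hqs
  have hqt : baseMap Φ u q ∈ H.target := H.map_source hqs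
  have hsc : Filter.Tendsto H.symm (𝓝 (baseMap Φ u q)) (𝓝 q) := by
    have := H.continuousAt_symm hqt
    rwa [ContinuousAt, hsy] at this
  have hgood : ∀ᶠ r in 𝓝 q, (r.1, r.2, u r) ∈ Ω ∧ (fderiv ℝ (baseMap Φ u) r).IsInvertible := by
    refine (hgr.continuousAt.eventually (hΩ.mem_nhds hq)).and ?_
    have hc : ContinuousAt (fderiv ℝ (baseMap Φ u)) q :=
      ((hB q hq).fderiv_right (m := 0) (by simp)).continuousAt
    exact hc.eventually (ContinuousLinearEquiv.isOpen.mem_nhds ⟨M, hM⟩)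
  obtain ⟨ε, hε, hball⟩ := Metric.mem_nhds_iff.1
    ((hsc.eventually hgood).and (H.open_target.mem_nhds hqt))
  let f : ContDiffBump (baseMap Φ u q) := ⟨ε / 4, ε / 2, by positivity, by linarith⟩
  have hsm : ∀ y ∈ Metric.ball (baseMap Φ u q) ε,
      ContDiffAt ℝ ∞ (fun y => (Φ ((H.symm y).1, (H.symm y).2, u (H.symm y))).2.2) y := by
    intro y hy
    obtain ⟨⟨hy1, N, hN⟩, hy2⟩ := hball hy
    have hs : ContDiffAt ℝ ∞ H.symm y := by
      refine H.contDiffAt_symm (f₀' := N) hy2 ?_ (hB _ hy1)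
      rw [hN]; exact ((hB _ hy1).differentiableAt (by simp)).hasFDerivAt
    have hc : ContDiffAt ℝ ∞ (fun y => Φ ((H.symm y).1, (H.symm y).2, u (H.symm y))) y :=
      ContDiffAt.comp y (f := fun y => ((H.symm y).1, (H.symm y).2, u (H.symm y))) (hΦ' _ hy1)
        (hs.fst.prodMk (hs.snd.prodMk (hu.contDiffAt.comp y hs)))
    exact hc.snd.snd
  refine ⟨fun y => f y * (Φ ((H.symm y).1, (H.symm y).2, u (H.symm y))).2.2, ?_, ⟨M, hM⟩, ?_⟩
  · rw [contDiff_iff_contDiffAt]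
    intro y
    by_cases hy : y ∈ tsupport f
    · rw [f.tsupport_eq] at hy
      exact f.contDiffAt.mul (hsm y (Metric.closedBall_subset_ball (half_lt_self hε) hy))
    · refine (contDiffAt_const (c := (0 : ℝ))).congr_of_eventuallyEq ?_
      filter_upwards [notMem_tsupport_iff_eventuallyEq.1 hy] with z hz
      simp [hz]
  · have h1 : ∀ᶠ r in 𝓝 q, f (baseMap Φ u r) = 1 :=
      (hB q hq).continuousAt.eventually f.eventuallyEq_one
    filter_upwards [h1, H.open_source.mem_nhds hqs] with r hr hrs
    have : H.symm (baseMap Φ u r) = r := H.left_inv hrs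
    simp only [hr, this, one_mul]

end transform

/-! ### First-order effect of a perturbation on the transform -/

open Asymptotics

theorem IsTransformAt.eq {Φ : ℝ × ℝ × ℝ → ℝ × ℝ × ℝ} {u v : ℝ × ℝ → ℝ} {q : ℝ × ℝ}
    (h : IsTransformAt Φ u v q) : v (baseMap Φ u q) = (Φ (q.1, q.2, u q)).2.2 :=
  h.2.self_of_nhds

/-- To first order, a perturbation of a function perturbs its transform by a nonzero multiple. -/
theorem exists_transform_sub_isLittleO {Φ : ℝ × ℝ × ℝ → ℝ × ℝ × ℝ} {u₁ u₂ v₁ v₂ : ℝ × ℝ → ℝ}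
    {q : ℝ × ℝ} (hΦ : ContDiffAt ℝ ∞ Φ (q.1, q.2, u₁ q))
    (hL : (fderiv ℝ Φ (q.1, q.2, u₁ q)).IsInvertible)
    (hu₁ : ContDiff ℝ ∞ u₁) (hu₂ : ContDiff ℝ ∞ u₂) (hv₂ : ContDiff ℝ ∞ v₂)
    (heq : u₂ q = u₁ q) (h₁ : IsTransformAt Φ u₁ v₁ q) (h₂ : IsTransformAt Φ u₂ v₂ q) :
    ∃ m : ℝ, m ≠ 0 ∧ (fun r => v₂ (baseMap Φ u₁ r) - v₁ (baseMap Φ u₁ r) - m * (u₂ r - u₁ r))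
      =o[𝓝 q] fun r => u₂ r - u₁ r := by
  set p : ℝ × ℝ × ℝ := (q.1, q.2, u₁ q) with hp
  set L := fderiv ℝ Φ p
  -- `G` measures how far the image of a point is from the graph of `v₂`. It vanishes on the graph
  -- of `u₂` near `p`, so `G'` kills the tangent plane of that graph and is determined by the number
  -- `G' (0, 0, 1)`, which serves as `m`.
  let G : ℝ × ℝ × ℝ → ℝ := fun P => (Φ P).2.2 - v₂ ((Φ P).1, (Φ P).2.1)
  have hΦs : HasStrictFDerivAt Φ L p := hΦ.hasStrictFDerivAt (by simp)
  have hv : HasStrictFDerivAt v₂ (fderiv ℝ v₂ ((Φ p).1, (Φ p).2.1)) ((Φ p).1, (Φ p).2.1) :=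
    hv₂.contDiffAt.hasStrictFDerivAt (by simp)
  have hG : HasStrictFDerivAt G _ p :=
    hΦs.snd.snd.sub (HasStrictFDerivAt.comp p
      (f := fun P => ((Φ P).1, (Φ P).2.1)) hv (hΦs.fst.prodMk hΦs.snd.fst))
  obtain ⟨G', hG'⟩ : ∃ G', HasStrictFDerivAt G G' p := ⟨_, hG⟩
  have hG0 : G' ≠ 0 := by
    obtain ⟨N, hN⟩ := hL
    intro h0
    have := hG.hasFDerivAt.unique (h0 ▸ hG'.hasFDerivAt)
    have h1 := DFunLike.congr_fun this (N.symm (0, 0, 1))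
    have h2 : L (N.symm (0, 0, 1)) = (0, 0, 1) := by
      have := N.apply_symm_apply (0, 0, 1)
      rwa [← ContinuousLinearEquiv.coe_coe, hN] at this
    have h3 : ((0 : ℝ), (0 : ℝ)) = 0 := rfl
    simp [h2, h3] at h1
  have hc : ∀ u : ℝ × ℝ → ℝ, ContDiff ℝ ∞ u → u q = u₁ q →
      Filter.Tendsto (fun r : ℝ × ℝ => (r.1, r.2, u r)) (𝓝 q) (𝓝 p) := fun u hu h => by
    have : Continuous fun r : ℝ × ℝ => (r.1, r.2, u r) :=
      continuous_fst.prodMk (continuous_snd.prodMk hu.continuous)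
    have := this.continuousAt (x := q)
    rwa [ContinuousAt, h] at this
  have hz : ∀ᶠ r in 𝓝 q, G (r.1, r.2, u₂ r) = 0 := by
    filter_upwards [h₂.2] with r hr
    simp only [G, sub_eq_zero]
    exact hr.symm
  have hder : ∀ d : ℝ × ℝ, G' (d.1, d.2, fderiv ℝ u₂ q d) = 0 := by
    have ha : HasFDerivAt (fun r : ℝ × ℝ => G (r.1, r.2, u₂ r)) (G'.comp
      ((ContinuousLinearMap.fst ℝ ℝ ℝ).prod
        ((ContinuousLinearMap.snd ℝ ℝ ℝ).prod (fderiv ℝ u₂ q)))) q := by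
      have hG2 : HasFDerivAt G G' (q.1, q.2, u₂ q) := by rw [heq]; exact hG'.hasFDerivAt
      exact HasFDerivAt.comp q (f := fun r : ℝ × ℝ => (r.1, r.2, u₂ r)) hG2
        (hasFDerivAt_fst.prodMk (hasFDerivAt_snd.prodMk
          (hu₂.differentiable (by simp) q).hasFDerivAt))
    have hb : HasFDerivAt (fun r : ℝ × ℝ => G (r.1, r.2, u₂ r)) (0 : ℝ × ℝ →L[ℝ] ℝ) q :=
      (hasFDerivAt_const (0 : ℝ) q).congr_of_eventuallyEq hz
    intro d
    have := DFunLike.congr_fun (ha.unique hb) d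
    simpa using this
  have hsplit : ∀ a b c : ℝ, G' (a, b, c) = G' (0, 0, 1) * (c - fderiv ℝ u₂ q (a, b)) := by
    intro a b c
    have h1 := hder (a, b)
    have h2 : ((a, b, c) : ℝ × ℝ × ℝ) = (a, b, fderiv ℝ u₂ q (a, b))
        + (c - fderiv ℝ u₂ q (a, b)) • (0, 0, 1) := by simp
    rw [h2, map_add, map_smul, h1]
    simp [mul_comm]
  refine ⟨G' (0, 0, 1), ?_, ?_⟩
  · intro h0
    apply hG0
    refine ContinuousLinearMap.ext fun ⟨a, b, c⟩ => ?_
    rw [hsplit, h0, zero_mul, zero_apply]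
  -- Strict differentiability is essential: `G` is compared at two moving points, one on each graph
  -- over the same `r`.
  · have hl := hG'.isLittleO.comp_tendsto
      ((hc u₁ hu₁ rfl).prodMk_nhds (hc u₂ hu₂ heq))
    have e1 : ∀ r : ℝ × ℝ, ((r.1, r.2, u₁ r) : ℝ × ℝ × ℝ) - (r.1, r.2, u₂ r)
        = (u₂ r - u₁ r) • (0, 0, -1) := fun r => by simp
    have e2 : ((0, 0, -1) : ℝ × ℝ × ℝ) = -(0, 0, 1) := by simp
    have hl' : (fun r => v₂ (baseMap Φ u₁ r) - v₁ (baseMap Φ u₁ r) -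
        G' (0, 0, 1) * (u₂ r - u₁ r)) =o[𝓝 q]
        fun r : ℝ × ℝ => ((r.1, r.2, u₁ r) : ℝ × ℝ × ℝ) - (r.1, r.2, u₂ r) := by
      refine (IsLittleO.neg_left hl).congr' ?_ ?_
      · filter_upwards [hz, h₁.2] with r hr hr₁
        simp only [Function.comp, hr]
        rw [e1, map_smul, e2, map_neg, smul_eq_mul]
        simp only [G, ← hr₁]
        simp only [baseMap]
        ring
      · exact .of_forall fun r => by simp [Function.comp]
    refine hl'.trans_isBigO ?_
    simp only [e1]
    refine IsBigO.of_bound ‖((0, 0, -1) : ℝ × ℝ × ℝ)‖ (.of_forall fun r => ?_)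
    rw [norm_smul, mul_comm]

/-- The same estimate in the new independent variables, in which the target equation differentiates.
-/
theorem exists_transform_sub_comp_isLittleO {Φ : ℝ × ℝ × ℝ → ℝ × ℝ × ℝ} {u₁ u₂ v₁ v₂ : ℝ × ℝ → ℝ}
    {q : ℝ × ℝ} (hΦ : ContDiffAt ℝ ∞ Φ (q.1, q.2, u₁ q))
    (hL : (fderiv ℝ Φ (q.1, q.2, u₁ q)).IsInvertible)
    (hu₁ : ContDiff ℝ ∞ u₁) (hu₂ : ContDiff ℝ ∞ u₂) (hv₂ : ContDiff ℝ ∞ v₂)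
    (heq : u₂ q = u₁ q) (h₁ : IsTransformAt Φ u₁ v₁ q) (h₂ : IsTransformAt Φ u₂ v₂ q) :
    ∃ m : ℝ, m ≠ 0 ∧ ∃ (R : ℝ × ℝ → ℝ × ℝ) (M : (ℝ × ℝ) ≃L[ℝ] ℝ × ℝ),
      (M : ℝ × ℝ →L[ℝ] ℝ × ℝ) = fderiv ℝ (baseMap Φ u₁) q ∧
      R (baseMap Φ u₁ q) = q ∧ (∀ᶠ y in 𝓝 (baseMap Φ u₁ q), baseMap Φ u₁ (R y) = y) ∧
      HasFDerivAt R (M.symm : ℝ × ℝ →L[ℝ] ℝ × ℝ) (baseMap Φ u₁ q) ∧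
      (fun y => v₂ y - v₁ y - m * (u₂ (R y) - u₁ (R y))) =o[𝓝 (baseMap Φ u₁ q)]
        fun y => u₂ (R y) - u₁ (R y) := by
  obtain ⟨m, hm, hml⟩ := exists_transform_sub_isLittleO hΦ hL hu₁ hu₂ hv₂ heq h₁ h₂
  obtain ⟨M, hM⟩ := h₁.1
  have hB : HasStrictFDerivAt (baseMap Φ u₁) (M : ℝ × ℝ →L[ℝ] ℝ × ℝ) q := by
    rw [hM]; exact (contDiffAt_baseMap hΦ hu₁.contDiffAt).hasStrictFDerivAt (by simp)
  have hRq : hB.localInverse _ _ _ (baseMap Φ u₁ q) = q :=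
    (hB.eventually_left_inverse).self_of_nhds
  have hR := hB.to_localInverse.hasFDerivAt
  refine ⟨m, hm, hB.localInverse, M, hM, hRq, hB.eventually_right_inverse, hR, ?_⟩
  have ht := hR.continuousAt.tendsto
  rw [hRq] at ht
  refine (hml.comp_tendsto ht).congr' ?_ .rfl
  filter_upwards [hB.eventually_right_inverse] with y hy
  simp only [Function.comp, hy]

theorem HasDerivAt.pow_five_sub_isLittleO {ρ : ℝ → ℝ} {d x₀ : ℝ} (h : HasDerivAt ρ d x₀)
    (h0 : ρ x₀ = 0) :
    (fun x => ρ x ^ 5 - d ^ 5 * (x - x₀) ^ 5) =o[𝓝 x₀] fun x => (x - x₀) ^ 5 := by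
  have h1 := h.isLittleO
  simp only [h0, sub_zero, smul_eq_mul] at h1
  have hb : (fun x : ℝ => (x - x₀) * d) =O[𝓝 x₀] fun x => x - x₀ := by
    simp_rw [mul_comm _ d]
    exact (isBigO_refl _ _).const_mul_left d
  have ha : ρ =O[𝓝 x₀] fun x => x - x₀ := by
    simpa using h1.isBigO.add hb
  -- The cofactor of `ρ - (x - x₀) d` in the factorization of the difference of fifth powers.
  have hs : (fun x => ρ x ^ 4 + ρ x ^ 3 * ((x - x₀) * d) + ρ x ^ 2 * ((x - x₀) * d) ^ 2
      + ρ x * ((x - x₀) * d) ^ 3 + ((x - x₀) * d) ^ 4) =O[𝓝 x₀] fun x => (x - x₀) ^ 4 := by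
    refine ((((ha.pow 4).add ?_).add ?_).add ?_).add (hb.pow 4)
    · exact ((ha.pow 3).mul hb).congr_right fun x => by ring
    · exact ((ha.pow 2).mul (hb.pow 2)).congr_right fun x => by ring
    · exact (ha.mul (hb.pow 3)).congr_right fun x => by ring
  exact (h1.mul_isBigO hs).congr (fun x => by ring) fun x => by ring

theorem deriv_of_sub_isLittleO_pow_five {F W ρ : ℝ → ℝ} {m c d x₀ : ℝ} (hF : ContDiff ℝ ∞ F)
    (hFW : (fun x => F x - m * W x) =o[𝓝 x₀] W) (hW : ∀ᶠ x in 𝓝 x₀, W x = c * ρ x ^ 5)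
    (hρ : HasDerivAt ρ d x₀) (h0 : ρ x₀ = 0) :
    iteratedDeriv 5 F x₀ = 120 * (m * (c * d ^ 5)) ∧ deriv F x₀ = 0 := by
  refine iteratedDeriv_of_isLittleO (α := 0) (by exact_mod_cast (contDiff_infty.1 hF 5).contDiffAt) ?_
  have h1 := hρ.pow_five_sub_isLittleO h0
  have hO : W =O[𝓝 x₀] fun x => (x - x₀) ^ 5 := by
    have h2 : (fun x => ρ x ^ 5) =O[𝓝 x₀] fun x => (x - x₀) ^ 5 := by
      refine (h1.isBigO.add ((isBigO_refl (fun x : ℝ => (x - x₀) ^ 5) _).const_mul_left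
        (d ^ 5))).congr_left fun x => by ring
    exact (h2.const_mul_left c).congr' (hW.mono fun x hx => hx.symm) .rfl
  refine ((hFW.trans_isBigO hO).add (h1.const_mul_left (m * c))).congr' ?_ .rfl
  filter_upwards [hW] with x hx
  rw [hx]; ring

theorem HasDerivAt.of_sub_isLittleO {F W : ℝ → ℝ} {m D x₀ : ℝ}
    (hFW : (fun x => F x - m * W x) =o[𝓝 x₀] W) (hW : HasDerivAt W D x₀) (h0 : W x₀ = 0) :
    HasDerivAt F (m * D) x₀ := by
  have hF0 : F x₀ = 0 := by
    have h := (hFW.def one_pos).self_of_nhds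
    simpa [h0] using h
  have hWO : W =O[𝓝 x₀] fun x => x - x₀ := by
    have := hW.isBigO_sub
    simpa [h0] using this
  have h1 : HasDerivAt (fun x => F x - m * W x) 0 x₀ := by
    rw [hasDerivAt_iff_isLittleO]
    simpa [hF0, h0] using hFW.trans_isBigO hWO
  refine ((h1.add (hW.const_mul m)).congr_deriv (by simp)).congr_of_eventuallyEq
    (.of_forall fun x => by simp)

/-! ### Perturbed jets; the new time depends on the old time alone -/

section admissible
variable {e e' : FKdV} {Ω : Set (ℝ × ℝ × ℝ)} {Φ : ℝ × ℝ × ℝ → ℝ × ℝ × ℝ}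

theorem IsAdmissible.contDiffAt (h : IsAdmissible e e' Ω Φ) {p : ℝ × ℝ × ℝ} (hp : p ∈ Ω) :
    ContDiffAt ℝ ∞ Φ p :=
  h.1.2.2.1.contDiffAt (h.1.1.mem_nhds hp)

theorem IsAdmissible.differentiableAt (h : IsAdmissible e e' Ω Φ) {p : ℝ × ℝ × ℝ} (hp : p ∈ Ω) :
    DifferentiableAt ℝ Φ p :=
  (h.contDiffAt hp).differentiableAt (by simp)

theorem IsAdmissible.exists_transform (h : IsAdmissible e e' Ω Φ) {u : ℝ × ℝ → ℝ}
    (hu : ContDiff ℝ ∞ u) {q : ℝ × ℝ} (hq : (q.1, q.2, u q) ∈ Ω) {α r : ℝ}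
    (hα : fderiv ℝ u q (1, 0) = α) (hr : fderiv ℝ u q (0, 1) = r)
    (hJ : (fderiv ℝ Φ (q.1, q.2, u q) (1, 0, α)).1 * (fderiv ℝ Φ (q.1, q.2, u q) (0, 1, r)).2.1
      - (fderiv ℝ Φ (q.1, q.2, u q) (1, 0, α)).2.1 * (fderiv ℝ Φ (q.1, q.2, u q) (0, 1, r)).1
      ≠ 0) :
    ∃ v, ContDiff ℝ ∞ v ∧ IsTransformAt Φ u v q ∧
      (e.HoldsAt u q ↔ e'.HoldsAt v (baseMap Φ u q)) := by
  have hd := fderiv_baseMap_apply (h.differentiableAt hq) (hu.differentiable (by simp) q)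
  obtain ⟨v, hv, ht⟩ := exists_isTransformAt h.1.1 h.1.2.2.1 hu hq
    (isInvertible_of_det_ne_zero (by rw [hd, hd, hα, hr]; exact hJ))
  exact ⟨v, hv, ht, h.2.2 u v hu hv q hq ht⟩

theorem tendsto_mk_left (y : ℝ × ℝ) : Filter.Tendsto (fun s => (y.1, s)) (𝓝 y.2) (𝓝 y) :=
  (by fun_prop : Continuous fun s : ℝ => (y.1, s)).tendsto y.2

theorem tendsto_mk_right (y : ℝ × ℝ) : Filter.Tendsto (fun s => (s, y.2)) (𝓝 y.1) (𝓝 y) :=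
  (by fun_prop : Continuous fun s : ℝ => (s, y.2)).tendsto y.1

/-- The change of the left-hand side of the equation in terms of the derivatives of the difference
of two functions with equal values at the point. -/
theorem FKdV.deriv_eq_of_holdsAt {e : FKdV} {v₁ v₂ : ℝ × ℝ → ℝ} {y : ℝ × ℝ} {D E : ℝ}
    (hv₁ : ContDiff ℝ ∞ v₁) (hv₂ : ContDiff ℝ ∞ v₂) (h₁ : e.HoldsAt v₁ y) (h₂ : e.HoldsAt v₂ y)
    (heq : v₂ y = v₁ y) (ht : HasDerivAt (fun s => v₂ (s, y.2) - v₁ (s, y.2)) D y.1)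
    (hx : deriv (fun s => v₂ (y.1, s) - v₁ (y.1, s)) y.2 = 0)
    (h5 : iteratedDeriv 5 (fun s => v₂ (y.1, s) - v₁ (y.1, s)) y.2 = E) :
    D + e.β y.1 * E = 0 := by
  have hd : ∀ v : ℝ × ℝ → ℝ, ContDiff ℝ ∞ v → ContDiff ℝ ∞ (fun s => v (y.1, s)) :=
    fun v hv => hv.comp (contDiff_const.prodMk contDiff_id)
  have hd' : ∀ v : ℝ × ℝ → ℝ, ContDiff ℝ ∞ v → ContDiff ℝ ∞ (fun s => v (s, y.2)) :=
    fun v hv => hv.comp (contDiff_id.prodMk contDiff_const)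
  have ht' := ht.deriv
  rw [deriv_fun_sub ((hd' v₂ hv₂).differentiable (by simp) _)
    ((hd' v₁ hv₁).differentiable (by simp) _)] at ht'
  rw [deriv_fun_sub ((hd v₂ hv₂).differentiable (by simp) _)
    ((hd v₁ hv₁).differentiable (by simp) _)] at hx
  rw [iteratedDeriv_fun_sub (contDiff_infty.1 (hd v₂ hv₂) 5).contDiffAt
    (contDiff_infty.1 (hd v₁ hv₁) 5).contDiffAt] at h5
  rw [FKdV.HoldsAt] at h₁ h₂
  rw [heq] at h₂
  rw [← ht', ← h5]
  linear_combination h₂ - h₁ - v₁ y ^ e.n * hx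

/-- The effect of a perturbation of a jet on the equation `e` which keeps the equation satisfied:
`R` is the local inverse of the map of the independent variables, `M` its derivative's inverse. -/
theorem IsAdmissible.perturbation (h : IsAdmissible e e' Ω Φ) {t x k : ℝ} (hp : (t, x, k) ∈ Ω)
    {α r A c η : ℝ} (hA : A + e.β t * (120 * c) = 0)
    (hJ : (fderiv ℝ Φ (t, x, k) (1, 0, α)).1 * (fderiv ℝ Φ (t, x, k) (0, 1, r)).2.1
      - (fderiv ℝ Φ (t, x, k) (1, 0, α)).2.1 * (fderiv ℝ Φ (t, x, k) (0, 1, r)).1 ≠ 0)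
    (hJ' : (fderiv ℝ Φ (t, x, k) (1, 0, α + A)).1 * (fderiv ℝ Φ (t, x, k) (0, 1, r)).2.1
      - (fderiv ℝ Φ (t, x, k) (1, 0, α + A)).2.1 * (fderiv ℝ Φ (t, x, k) (0, 1, r)).1 ≠ 0) :
    ∃ (u : ℝ × ℝ → ℝ) (R : ℝ × ℝ → ℝ × ℝ) (M : (ℝ × ℝ) ≃L[ℝ] ℝ × ℝ) (y : ℝ × ℝ),
      Continuous u ∧ u (t, x) = k ∧ y.1 = (Φ (t, x, k)).1 ∧
      (M (1, 0)).1 = (fderiv ℝ Φ (t, x, k) (1, 0, α)).1 ∧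
      M (0, 1) = ((fderiv ℝ Φ (t, x, k) (0, 1, r)).1, (fderiv ℝ Φ (t, x, k) (0, 1, r)).2.1) ∧
      R y = (t, x) ∧ (∀ᶠ z in 𝓝 y, baseMap Φ u (R z) = z) ∧
      HasFDerivAt R (M.symm : ℝ × ℝ →L[ℝ] ℝ × ℝ) y ∧
      ∀ (ρ : ℝ → ℝ) (b d : ℝ), HasDerivAt ρ d y.2 → ρ y.2 = 0 →
        (∀ᶠ s in 𝓝 y.2, A * ((R (y.1, s)).1 - t) + c * ((R (y.1, s)).2 - x) ^ 5
          + η * ((R (y.1, s)).1 - t) ^ 5 = b * ρ s ^ 5) →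
        A * (M.symm (1, 0)).1 + e'.β (Φ (t, x, k)).1 * (120 * (b * d ^ 5)) = 0 := by
  have hβ : e.β t ≠ 0 := e.β_ne_zero t (h.2.1 _ hp).1
  set q : ℝ × ℝ := (t, x)
  -- The fifth-order coefficient is solved for from the equation, so `α` and `r` stay free. The
  -- condition `hA` then keeps the equation true for `u₂`.
  set γ : ℝ := -(α + k ^ e.n * r) / (120 * e.β t) with hγ
  set u₁ := jetPoly q k α r 0 γ 0
  set u₂ := jetPoly q k (α + A) r 0 (γ + c) η
  have hu₁ : ContDiff ℝ ∞ u₁ := contDiff_jetPoly ..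
  have hu₂ : ContDiff ℝ ∞ u₂ := contDiff_jetPoly ..
  have hq₁ : u₁ q = k := jetPoly_self ..
  have hq₂ : u₂ q = k := jetPoly_self ..
  obtain ⟨v₁, hv₁, ht₁, hi₁⟩ := h.exists_transform hu₁ (q := q) (by rw [hq₁]; exact hp)
    (fderiv_jetPoly_fst ..) (fderiv_jetPoly_snd ..) (by rw [hq₁]; exact hJ)
  obtain ⟨v₂, hv₂, ht₂, hi₂⟩ := h.exists_transform hu₂ (q := q) (by rw [hq₂]; exact hp)
    (fderiv_jetPoly_fst ..) (fderiv_jetPoly_snd ..) (by rw [hq₂]; exact hJ')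
  have hz : α + k ^ e.n * r + e.β q.1 * (120 * γ) = 0 := by
    simp only [hγ, q]; field_simp; ring
  have H₁ := hi₁.1 ((holdsAt_jetPoly ..).2 hz)
  have H₂ := hi₂.1 ((holdsAt_jetPoly ..).2 (by simp only [q] at hz ⊢; linear_combination hz + hA))
  have hbb : baseMap Φ u₂ q = baseMap Φ u₁ q := by simp only [baseMap, hq₁, hq₂]
  rw [hbb] at H₂
  obtain ⟨m, hm, R, M, hM, hRq, hBR, hR, hlo⟩ := exists_transform_sub_comp_isLittleO
    (q := q) (by rw [hq₁]; exact h.contDiffAt hp) (by rw [hq₁]; exact h.1.2.2.2.2 _ hp)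
    hu₁ hu₂ hv₂ (by rw [hq₁, hq₂]) ht₁ ht₂
  have hw : ∀ z : ℝ × ℝ, u₂ z - u₁ z = A * (z.1 - t) + c * (z.2 - x) ^ 5 + η * (z.1 - t) ^ 5 :=
    fun z => by simp only [u₁, u₂, jetPoly, q]; ring
  simp only [hw] at hlo
  set y := baseMap Φ u₁ q with hy
  have hy1 : y.1 = (Φ (t, x, k)).1 := by simp only [hy, baseMap, hq₁, q]
  have hMd := fderiv_baseMap_apply (q := q)
    (by rw [hq₁]; exact h.differentiableAt hp) (hu₁.differentiable (by simp) q)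
  rw [← hM, hq₁] at hMd
  have hMd1 := hMd (1, 0)
  have hMd2 := hMd (0, 1)
  rw [fderiv_jetPoly_fst] at hMd1
  rw [fderiv_jetPoly_snd] at hMd2
  refine ⟨u₁, R, M, y, hu₁.continuous, hq₁, hy1, congrArg Prod.fst hMd1, hMd2, hRq, hBR, hR, ?_⟩
  intro ρ b d hρ h0 hW
  -- Along the line of constant new time the difference is of fifth order, so its first derivative
  -- vanishes and only the fifth contributes. In the new time direction only the linear term `A`
  -- contributes.
  have hx := deriv_of_sub_isLittleO_pow_five
    (F := fun s => v₂ (y.1, s) - v₁ (y.1, s))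
    ((hv₂.comp (contDiff_const.prodMk contDiff_id)).sub
      (hv₁.comp (contDiff_const.prodMk contDiff_id)))
    (hlo.comp_tendsto (tendsto_mk_left y)) hW hρ h0
  have hd1 := hR.fst.deriv_fst.sub_const t
  have hd2 := hR.snd.deriv_fst.sub_const x
  have ht := HasDerivAt.of_sub_isLittleO (hlo.comp_tendsto (tendsto_mk_right y))
    (((hd1.const_mul A).add ((hd2.pow 5).const_mul c)).add ((hd1.pow 5).const_mul η))
    (by simp [hRq, q])
  have key := FKdV.deriv_eq_of_holdsAt hv₁ hv₂ H₁ H₂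
    (by rw [ht₁.eq, ← hbb, ht₂.eq, hq₁, hq₂]) ht hx.2 hx.1
  rw [show R (y.1, y.2) = (t, x) from hRq, hy1] at key
  refine (mul_eq_zero.1 (Eq.trans ?_ key)).resolve_left hm
  simp
  ring

/-- Perturbing by `(t - t₀)^5` leaves the source equation untouched, while the target equation
acquires `120 β' d^5` up to a nonzero factor, where `d` is the derivative of the old time in the new
space variable. Hence `d = 0`, which for the inverse Jacobian means `D_x T = 0`. -/
theorem IsAdmissible.fderiv_fst_eq_zero_of_det (h : IsAdmissible e e' Ω Φ) {p : ℝ × ℝ × ℝ}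
    (hp : p ∈ Ω) {α r : ℝ}
    (hJ : (fderiv ℝ Φ p (1, 0, α)).1 * (fderiv ℝ Φ p (0, 1, r)).2.1
      - (fderiv ℝ Φ p (1, 0, α)).2.1 * (fderiv ℝ Φ p (0, 1, r)).1 ≠ 0) :
    (fderiv ℝ Φ p (0, 1, r)).1 = 0 := by
  by_contra hne
  obtain ⟨t, x, k⟩ := p
  obtain ⟨u, R, M, y, -, -, -, -, hM, hRy, -, hR, key⟩ := h.perturbation hp (A := 0) (c := 0)
    (η := 1) (by simp) hJ (by rwa [add_zero])
  have hβ' : e'.β (Φ (t, x, k)).1 ≠ 0 := e'.β_ne_zero _ (h.2.1 _ hp).2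
  have hd := key _ 1 _ (hR.fst.deriv_snd.sub_const t) (by simp [hRy])
    (.of_forall fun s => by ring)
  replace hd : (M.symm (0, 1)).1 = 0 := by simpa [hβ'] using hd
  have hMM := M.apply_symm_apply (0, 1)
  have hs : M.symm (0, 1) = (M.symm (0, 1)).2 • (0, 1) := by
    ext <;> simp [hd]
  rw [hs, map_smul, hM] at hMM
  have h1 := congrArg Prod.fst hMM
  have h2 := congrArg Prod.snd hMM
  simp only [Prod.smul_fst, Prod.smul_snd, smul_eq_mul] at h1 h2
  rcases mul_eq_zero.1 h1 with h0 | h0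
  · rw [h0, zero_mul] at h2; exact zero_ne_one h2
  · exact hne h0

theorem ContinuousLinearMap.apply_triple {F : Type*} [NormedAddCommGroup F] [NormedSpace ℝ F]
    (L : ℝ × ℝ × ℝ →L[ℝ] F) (a b c : ℝ) :
    L (a, b, c) = a • L (1, 0, 0) + b • L (0, 1, 0) + c • L (0, 0, 1) := by
  rw [← map_smul, ← map_smul, ← map_smul, ← map_add, ← map_add]; simp

/-- The new time depends on the old time only. -/
theorem IsAdmissible.fderiv_fst_eq_zero (h : IsAdmissible e e' Ω Φ) {p : ℝ × ℝ × ℝ}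
    (hp : p ∈ Ω) : (fderiv ℝ Φ p (0, 1, 0)).1 = 0 ∧ (fderiv ℝ Φ p (0, 0, 1)).1 = 0 := by
  have hdet := fun α r => h.fderiv_fst_eq_zero_of_det hp (α := α) (r := r)
  obtain ⟨N, hN⟩ := h.1.2.2.2.2 p hp
  set L := fderiv ℝ Φ p
  have hs : ∀ P, L (N.symm P) = P := fun P => by
    rw [← hN]; exact N.apply_symm_apply P
  obtain ⟨a₁, a₂, a₃, e1⟩ : ∃ a b c, L (a, b, c) = (1, 0, 0) := ⟨_, _, _, hs _⟩
  obtain ⟨b₁, b₂, b₃, e2⟩ : ∃ a b c, L (a, b, c) = (0, 1, 0) := ⟨_, _, _, hs _⟩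
  obtain ⟨V, hV⟩ : ∃ V, L (1, 0, 0) = V := ⟨_, rfl⟩
  obtain ⟨Y, hY⟩ : ∃ Y, L (0, 1, 0) = Y := ⟨_, rfl⟩
  obtain ⟨Z, hZ⟩ : ∃ Z, L (0, 0, 1) = Z := ⟨_, rfl⟩
  have hsplit : ∀ a b c, L (a, b, c) = a • V + b • Y + c • Z := fun a b c => by
    rw [ContinuousLinearMap.apply_triple, hV, hY, hZ]
  rw [hY, hZ]
  simp only [hsplit] at e1 e2 hdet
  obtain ⟨T₁, X₁, U₁⟩ := V
  obtain ⟨T₂, X₂, U₂⟩ := Y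
  obtain ⟨T₃, X₃, U₃⟩ := Z
  simp only [Prod.smul_mk, smul_eq_mul, Prod.mk_add_mk, Prod.mk.injEq, one_mul, zero_mul, zero_add,
    add_zero] at e1 e2 hdet ⊢
  by_contra hcon
  -- Two nondegenerate jets with different `u_x` suffice, since `T₂ + r T₃` would vanish at both.
  -- The Jacobian equals `A + r C + α B` with `A = T₁X₂ - X₁T₂`, `C = T₁X₃ - X₁T₃`, `B = T₃X₂ -
  -- X₃T₂`; the remaining cases choose `r` and `α` to make it nonzero.
  have h0 : ∀ r₁ r₂ α₁ α₂ : ℝ, r₁ ≠ r₂ →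
      (T₁ + α₁ * T₃) * (X₂ + r₁ * X₃) - (X₁ + α₁ * X₃) * (T₂ + r₁ * T₃) ≠ 0 →
      (T₁ + α₂ * T₃) * (X₂ + r₂ * X₃) - (X₁ + α₂ * X₃) * (T₂ + r₂ * T₃) ≠ 0 → False := by
    intro r₁ r₂ α₁ α₂ hr h1 h2
    have g1 := hdet α₁ r₁ h1
    have g2 := hdet α₂ r₂ h2
    have g3 : T₃ = 0 := by
      refine (mul_eq_zero.1 (?_ : (r₁ - r₂) * T₃ = 0)).resolve_left (sub_ne_zero.2 hr)
      linear_combination g1 - g2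
    exact hcon ⟨by rw [g3] at g1; linarith, g3⟩
  have hB : T₃ * X₂ - X₃ * T₂ = 0 := by
    by_contra hB
    set B := T₃ * X₂ - X₃ * T₂
    have hα : ∀ r, ∃ α : ℝ,
        (T₁ + α * T₃) * (X₂ + r * X₃) - (X₁ + α * X₃) * (T₂ + r * T₃) ≠ 0 := by
      intro r
      by_contra! hc
      have c0 := hc 0
      have c1 := hc 1
      exact hB (by simp only [B]; linear_combination c1 - c0)
    obtain ⟨α₁, h1⟩ := hα 0
    obtain ⟨α₂, h2⟩ := hα 1
    exact h0 0 1 α₁ α₂ zero_ne_one h1 h2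
  have hJ : ∀ r, T₁ * X₂ - X₁ * T₂ + r * (T₁ * X₃ - X₁ * T₃) ≠ 0 →
      (T₁ + 0 * T₃) * (X₂ + r * X₃) - (X₁ + 0 * X₃) * (T₂ + r * T₃) ≠ 0 := fun r hr hc =>
    hr (by linear_combination hc)
  -- Otherwise all 2×2 minors of the rows `T` and `X` vanish. The certificate is the Cauchy–Binet
  -- formula for the product of these rows with the preimages of two basis vectors, whose
  -- determinant is 1.
  have hAC : T₁ * X₂ - X₁ * T₂ ≠ 0 ∨ T₁ * X₃ - X₁ * T₃ ≠ 0 := by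
    by_contra! hc
    obtain ⟨hA, hC⟩ := hc
    obtain ⟨x1, x2, -⟩ := e1
    obtain ⟨y1, y2, -⟩ := e2
    refine zero_ne_one (α := ℝ) ?_
    linear_combination -(a₁ * b₂ - a₂ * b₁) * hA - (a₁ * b₃ - a₃ * b₁) * hC
      + (a₂ * b₃ - a₃ * b₂) * hB + (b₁ * X₁ + b₂ * X₂ + b₃ * X₃) * x1 + y2
      - (a₁ * X₁ + a₂ * X₂ + a₃ * X₃) * y1
  by_cases hC : T₁ * X₃ - X₁ * T₃ = 0
  · have hA := hAC.resolve_right (by simpa using hC)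
    exact h0 0 1 0 0 zero_ne_one (hJ 0 (by rw [hC]; simpa using hA))
      (hJ 1 (by rw [hC]; simpa using hA))
  · set A := T₁ * X₂ - X₁ * T₂
    set C := T₁ * X₃ - X₁ * T₃
    -- These values of `r` give the Jacobian the values 1 and 2.
    refine h0 ((1 - A) / C) ((2 - A) / C) 0 0 ?_ (hJ _ ?_) (hJ _ ?_)
    · intro hh
      rw [div_left_inj' hC] at hh
      linarith
    · rw [div_mul_cancel₀ _ hC]; simp
    · rw [div_mul_cancel₀ _ hC]; simp

end admissible

/-! ### Mean value tools; the new space variable is affine in `x` -/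

theorem exists_segment_sub_eq_fderiv {E : Type*} [NormedAddCommGroup E] [NormedSpace ℝ E] {f : E → ℝ}
    {K : Set E} (hK : Convex ℝ K) (hf : ∀ Z ∈ K, DifferentiableAt ℝ f Z) {P Q : E} (hP : P ∈ K)
    (hQ : Q ∈ K) : ∃ Z ∈ segment ℝ P Q, Z ∈ K ∧ f Q - f P = fderiv ℝ f Z (Q - P) := by
  obtain ⟨Z, hZ, h⟩ := domain_mvt (fun Z hZ => (hf Z hZ).hasFDerivAt.hasFDerivWithinAt) hK hP hQ
  exact ⟨Z, hZ, hK.segment_subset hP hQ hZ, h⟩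

theorem fst_eq_of_mem_segment {F : Type*} [AddCommGroup F] [Module ℝ F] {P Q Z : ℝ × F}
    (hZ : Z ∈ segment ℝ P Q) (h : P.1 = Q.1) : Z.1 = P.1 := by
  obtain ⟨a, b, -, -, hab, rfl⟩ := hZ
  simp only [Prod.fst_add, Prod.smul_fst, ← h, ← add_smul, hab, one_smul]

theorem mk_mem_ball {E F : Type*} [PseudoMetricSpace E] [PseudoMetricSpace F] {p P Q : E × F} {ε : ℝ}
    (hP : P ∈ Metric.ball p ε) (hQ : Q ∈ Metric.ball p ε) : (P.1, Q.2) ∈ Metric.ball p ε := by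
  rw [Metric.mem_ball, Prod.dist_eq] at *
  exact max_lt ((le_max_left _ _).trans_lt hP) ((le_max_right _ _).trans_lt hQ)

theorem iteratedDeriv_comp_affine {g : ℝ → ℝ} (hg : ContDiff ℝ ∞ g) (k : ℕ) (a b s₀ : ℝ) :
    iteratedDeriv k (fun s => g (b + a * (s - s₀))) s₀ = a ^ k * iteratedDeriv k g b := by
  have h1 : (fun s => g (b + a * (s - s₀))) = fun s => (fun z => g (z + (b - a * s₀))) (a * s) := by
    funext s; congr 1; ring
  have h2 : ContDiff ℝ k (fun z => g (z + (b - a * s₀))) :=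
    (contDiff_infty.1 hg k).comp (contDiff_id.add contDiff_const)
  rw [h1, iteratedDeriv_comp_const_mul h2]
  simp only [iteratedDeriv_comp_add_const]
  congr 2; ring

section deriv
variable {Φ : ℝ × ℝ × ℝ → ℝ × ℝ × ℝ} {p : ℝ × ℝ × ℝ}

theorem fderiv_comp_fst (h : DifferentiableAt ℝ Φ p) (d : ℝ × ℝ × ℝ) :
    fderiv ℝ (fun P => (Φ P).1) p d = (fderiv ℝ Φ p d).1 := by
  rw [h.hasFDerivAt.fst.fderiv]; rfl

theorem fderiv_comp_snd_fst (h : DifferentiableAt ℝ Φ p) (d : ℝ × ℝ × ℝ) :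
    fderiv ℝ (fun P => (Φ P).2.1) p d = (fderiv ℝ Φ p d).2.1 := by
  rw [h.hasFDerivAt.snd.fst.fderiv]; rfl

theorem fderiv_comp_snd_snd (h : DifferentiableAt ℝ Φ p) (d : ℝ × ℝ × ℝ) :
    fderiv ℝ (fun P => (Φ P).2.2) p d = (fderiv ℝ Φ p d).2.2 := by
  rw [h.hasFDerivAt.snd.snd.fderiv]; rfl

theorem hasDerivAt_slice_fst {f : ℝ × ℝ × ℝ → ℝ} {f' : ℝ × ℝ × ℝ →L[ℝ] ℝ} (h : HasFDerivAt f f' p) :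
    HasDerivAt (fun s => f (s, p.2)) (f' (1, 0, 0)) p.1 :=
  HasFDerivAt.comp_hasDerivAt (f := fun s : ℝ => (s, p.2)) p.1 h
    ((hasDerivAt_id p.1).prodMk (hasDerivAt_const _ _))

end deriv

section admissible
variable {e e' : FKdV} {Ω : Set (ℝ × ℝ × ℝ)} {Φ : ℝ × ℝ × ℝ → ℝ × ℝ × ℝ}

/-- Integration is confined to balls, because the slices of a connected `Ω` at fixed `t` may be
disconnected. -/
theorem IsAdmissible.fst_eq_of_fst_eq (h : IsAdmissible e e' Ω Φ) {p₀ : ℝ × ℝ × ℝ} {ε : ℝ}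
    (hK : Metric.ball p₀ ε ⊆ Ω) {P Q : ℝ × ℝ × ℝ} (hP : P ∈ Metric.ball p₀ ε)
    (hQ : Q ∈ Metric.ball p₀ ε) (hPQ : P.1 = Q.1) : (Φ P).1 = (Φ Q).1 := by
  obtain ⟨Z, -, hZ, h1⟩ := exists_segment_sub_eq_fderiv (f := fun P => (Φ P).1) (convex_ball p₀ ε)
    (fun Z hZ => (h.differentiableAt (hK hZ)).fst) hP hQ
  have h2 := h.fderiv_fst_eq_zero (hK hZ)
  rw [fderiv_comp_fst (h.differentiableAt (hK hZ)),
    show Q - P = (0, (Q - P).2.1, (Q - P).2.2) from Prod.ext (by simp [hPQ]) rfl,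
    ContinuousLinearMap.apply_triple] at h1
  simp only [zero_smul, zero_add, Prod.fst_add, Prod.smul_fst, h2, smul_zero, add_zero] at h1
  linarith

theorem IsAdmissible.fderiv_fst_ne_zero (h : IsAdmissible e e' Ω Φ) {p : ℝ × ℝ × ℝ}
    (hp : p ∈ Ω) : (fderiv ℝ Φ p (1, 0, 0)).1 ≠ 0 := by
  obtain ⟨N, hN⟩ := h.1.2.2.2.2 p hp
  obtain ⟨h1, h2⟩ := h.fderiv_fst_eq_zero hp
  have hs : fderiv ℝ Φ p (N.symm (1, 0, 0)) = (1, 0, 0) := by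
    rw [← hN]; exact N.apply_symm_apply _
  obtain ⟨a, b, c⟩ := N.symm (1, 0, 0)
  rw [ContinuousLinearMap.apply_triple] at hs
  have := congrArg Prod.fst hs
  simp only [Prod.fst_add, Prod.smul_fst, h1, h2, mul_zero, add_zero, smul_eq_mul] at this
  intro h0
  rw [h0, mul_zero] at this
  exact zero_ne_one this

theorem IsAdmissible.eventually_fst_eq (h : IsAdmissible e e' Ω Φ) {p : ℝ × ℝ × ℝ}
    (hp : p ∈ Ω) : ∀ᶠ P in 𝓝 p, (Φ P).1 = (Φ p).1 → P.1 = p.1 := by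
  obtain ⟨ε, hε, hK⟩ := Metric.isOpen_iff.1 h.1.1 p hp
  have hd : HasDerivAt (fun s => (Φ (s, p.2)).1) (fderiv ℝ Φ p (1, 0, 0)).1 p.1 :=
    hasDerivAt_slice_fst (f := fun P => (Φ P).1) (h.differentiableAt hp).hasFDerivAt.fst
  have hn := hd.eventually_ne (c := (Φ p).1) (h.fderiv_fst_ne_zero hp)
  rw [eventually_nhdsWithin_iff] at hn
  filter_upwards [continuous_fst.continuousAt.eventually hn, Metric.ball_mem_nhds p hε]
    with P hP hPK heq
  by_contra hne
  refine hP hne ?_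
  rw [← heq]
  have hpK := Metric.mem_ball_self (x := p) hε
  exact h.fst_eq_of_fst_eq hK (mk_mem_ball hPK hpK) hPK rfl

/-- Obtained from the perturbation `-β (t - t₀) + (x - x₀)^5 / 120`, whose two contributions to the
source equation cancel. -/
theorem IsAdmissible.coeff_mul_of_ne_zero (h : IsAdmissible e e' Ω Φ) {p : ℝ × ℝ × ℝ}
    (hp : p ∈ Ω) {r : ℝ} (hr : (fderiv ℝ Φ p (0, 1, r)).2.1 ≠ 0) :
    e'.β (Φ p).1 * (fderiv ℝ Φ p (1, 0, 0)).1
      = e.β p.1 * (fderiv ℝ Φ p (0, 1, r)).2.1 ^ 5 := by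
  obtain ⟨h1, h2⟩ := h.fderiv_fst_eq_zero hp
  have hτ := h.fderiv_fst_ne_zero hp
  have hT : ∀ a b c, (fderiv ℝ Φ p (a, b, c)).1 = a * (fderiv ℝ Φ p (1, 0, 0)).1 := by
    intro a b c
    rw [ContinuousLinearMap.apply_triple]
    simp only [Prod.fst_add, Prod.smul_fst, h1, h2, mul_zero, add_zero, smul_eq_mul]
  have hev := h.eventually_fst_eq hp
  obtain ⟨t, x, k⟩ := p
  have hJ : ∀ α, (fderiv ℝ Φ (t, x, k) (1, 0, α)).1 * (fderiv ℝ Φ (t, x, k) (0, 1, r)).2.1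
      - (fderiv ℝ Φ (t, x, k) (1, 0, α)).2.1 * (fderiv ℝ Φ (t, x, k) (0, 1, r)).1 ≠ 0 := by
    intro α
    rw [hT 1, hT 0, one_mul, zero_mul, mul_zero, sub_zero]
    exact mul_ne_zero hτ hr
  obtain ⟨u, R, M, y, hu, huk, hy, hM1, hM2, hRy, hBR, hR, key⟩ := h.perturbation hp (α := 0) (r := r)
    (A := -e.β t) (c := 1 / 120) (η := 0) (by ring) (hJ _) (hJ _)
  rw [hT 1, one_mul] at hM1
  rw [hT 0, zero_mul] at hM2
  have hlim : Filter.Tendsto (fun s => ((R (y.1, s)).1, (R (y.1, s)).2, u (R (y.1, s)))) (𝓝 y.2)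
      (𝓝 (t, x, k)) := by
    have hc := hR.continuousAt.tendsto.comp (tendsto_mk_left y)
    rw [hRy] at hc
    have hu' := hu.tendsto (t, x)
    rw [huk] at hu'
    have h3 := ((continuous_fst.tendsto (t, x)).comp hc).prodMk_nhds
      (((continuous_snd.tendsto (t, x)).comp hc).prodMk_nhds (hu'.comp hc))
    exact h3
  -- As `T` is locally injective in `t`, fixing the new time fixes the old one, so the linear part
  -- of the perturbation drops out along this line.
  have ht : ∀ᶠ s in 𝓝 y.2, (R (y.1, s)).1 = t := by
    filter_upwards [hlim.eventually hev, (tendsto_mk_left y).eventually hBR] with s hs hb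
    refine hs ?_
    rw [← hy]
    exact congrArg Prod.fst hb
  have := key _ (1 / 120) _ (hR.snd.deriv_snd.sub_const x) (by simp [hRy]) (by
    filter_upwards [ht] with s hs
    rw [hs]; ring)
  set D := (fderiv ℝ Φ (t, x, k) (0, 1, r)).2.1
  have e2 : M.symm (0, 1) = (0, D⁻¹) := by
    rw [ContinuousLinearEquiv.symm_apply_eq,
      show ((0 : ℝ), D⁻¹) = D⁻¹ • (0, 1) by simp, map_smul, hM2]
    simp [hr]
  have e1 : (M.symm (1, 0)).1 * (fderiv ℝ Φ (t, x, k) (1, 0, 0)).1 = 1 := by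
    have h3 := M.apply_symm_apply (1, 0)
    rw [show M.symm (1, 0) = (M.symm (1, 0)).1 • (1, 0) + (M.symm (1, 0)).2 • (0, 1) by
      ext <;> simp, map_add, map_smul, map_smul, hM2] at h3
    have h4 := congrArg Prod.fst h3
    simpa [hM1] using h4
  have e3 : ((ContinuousLinearMap.snd ℝ ℝ ℝ).comp (M.symm : ℝ × ℝ →L[ℝ] ℝ × ℝ)) (0, 1) = D⁻¹ := by
    simp [e2]
  rw [e3] at this
  have hD : D ^ 5 * D⁻¹ ^ 5 = 1 := by rw [← mul_pow, mul_inv_cancel₀ hr, one_pow]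
  linear_combination (D ^ 5 * (fderiv ℝ Φ (t, x, k) (1, 0, 0)).1) * this
    + e.β t * D ^ 5 * e1 - e'.β (Φ (t, x, k)).1 * (fderiv ℝ Φ (t, x, k) (1, 0, 0)).1 * hD

/-- The new space variable does not depend on `u`. -/
theorem IsAdmissible.fderiv_snd_fst_eq_zero (h : IsAdmissible e e' Ω Φ) {p : ℝ × ℝ × ℝ}
    (hp : p ∈ Ω) : (fderiv ℝ Φ p (0, 0, 1)).2.1 = 0 := by
  by_contra hne
  obtain ⟨a, ha⟩ : ∃ a, (fderiv ℝ Φ p (0, 1, 0)).2.1 = a := ⟨_, rfl⟩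
  obtain ⟨b, hb⟩ : ∃ b, (fderiv ℝ Φ p (0, 0, 1)).2.1 = b := ⟨_, rfl⟩
  rw [hb] at hne
  have hs : ∀ r, (fderiv ℝ Φ p (0, 1, r)).2.1 = a + r * b := fun r => by
    rw [ContinuousLinearMap.apply_triple]; simp [ha, hb]
  have key := fun r => h.coeff_mul_of_ne_zero hp (r := r)
  simp only [hs] at key
  -- If `X_u ≠ 0`, suitable `u_x` make `D_x X` equal to 1 and to 2, whence `β = 32 β`.
  have k1 := key ((1 - a) / b)
  have k2 := key ((2 - a) / b)
  simp only [div_mul_cancel₀ _ hne, add_sub_cancel] at k1 k2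
  have := (k1 one_ne_zero).symm.trans (k2 two_ne_zero)
  exact e.β_ne_zero _ (h.2.1 p hp).1 (by linarith)

theorem IsAdmissible.fderiv_diag_ne_zero (h : IsAdmissible e e' Ω Φ) {p : ℝ × ℝ × ℝ}
    (hp : p ∈ Ω) : (fderiv ℝ Φ p (0, 1, 0)).2.1 ≠ 0 ∧ (fderiv ℝ Φ p (0, 0, 1)).2.2 ≠ 0 := by
  obtain ⟨N, hN⟩ := h.1.2.2.2.2 p hp
  obtain ⟨h1, h2⟩ := h.fderiv_fst_eq_zero hp
  have h3 := h.fderiv_snd_fst_eq_zero hp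
  have hτ := h.fderiv_fst_ne_zero hp
  have hs : ∀ P, ∃ a b c, fderiv ℝ Φ p (a, b, c) = P := fun P =>
    ⟨_, _, _, by rw [← hN]; exact N.apply_symm_apply P⟩
  have hX : (fderiv ℝ Φ p (0, 1, 0)).2.1 ≠ 0 := by
    intro h0
    obtain ⟨a, b, c, hs⟩ := hs (0, 1, 0)
    rw [ContinuousLinearMap.apply_triple] at hs
    have e1 := congrArg Prod.fst hs
    have e2 := congrArg (fun P => P.2.1) hs
    simp [h1, h2, hτ] at e1
    simp [h0, h3, e1] at e2
  refine ⟨hX, fun h0 => ?_⟩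
  obtain ⟨a, b, c, hs⟩ := hs (0, 0, 1)
  rw [ContinuousLinearMap.apply_triple] at hs
  have e1 := congrArg Prod.fst hs
  have e2 := congrArg (fun P => P.2.1) hs
  have e3 := congrArg (fun P => P.2.2) hs
  simp [h1, h2, hτ] at e1
  simp [h3, e1, hX] at e2
  simp [h0, e1, e2] at e3

theorem IsAdmissible.coeff_mul (h : IsAdmissible e e' Ω Φ) {p : ℝ × ℝ × ℝ} (hp : p ∈ Ω) :
    e'.β (Φ p).1 * (fderiv ℝ Φ p (1, 0, 0)).1
      = e.β p.1 * (fderiv ℝ Φ p (0, 1, 0)).2.1 ^ 5 :=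
  h.coeff_mul_of_ne_zero hp (h.fderiv_diag_ne_zero hp).1

theorem IsAdmissible.fderiv_fst_congr (h : IsAdmissible e e' Ω Φ) {p₀ : ℝ × ℝ × ℝ} {ε : ℝ}
    (hK : Metric.ball p₀ ε ⊆ Ω) {P Q : ℝ × ℝ × ℝ} (hP : P ∈ Metric.ball p₀ ε)
    (hQ : Q ∈ Metric.ball p₀ ε) (hPQ : P.1 = Q.1) :
    (fderiv ℝ Φ P (1, 0, 0)).1 = (fderiv ℝ Φ Q (1, 0, 0)).1 := by
  have h1 : HasDerivAt (fun s => (Φ (s, P.2)).1) (fderiv ℝ Φ P (1, 0, 0)).1 P.1 :=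
    hasDerivAt_slice_fst (f := fun P => (Φ P).1) (h.differentiableAt (hK hP)).hasFDerivAt.fst
  have h2 : HasDerivAt (fun s => (Φ (s, Q.2)).1) (fderiv ℝ Φ Q (1, 0, 0)).1 Q.1 :=
    hasDerivAt_slice_fst (f := fun P => (Φ P).1) (h.differentiableAt (hK hQ)).hasFDerivAt.fst
  rw [← hPQ] at h2
  refine h1.unique (h2.congr_of_eventuallyEq ?_)
  have hc : ∀ Z : ℝ × ℝ × ℝ, Z ∈ Metric.ball p₀ ε → Z.1 = P.1 →
      ∀ᶠ s in 𝓝 P.1, (s, Z.2) ∈ Metric.ball p₀ ε := by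
    intro Z hZ hZP
    refine (by fun_prop : Continuous fun s : ℝ => (s, Z.2)).continuousAt.eventually
      (Metric.isOpen_ball.mem_nhds ?_)
    rw [← hZP]; exact hZ
  filter_upwards [hc P hP rfl, hc Q hQ hPQ.symm] with s hs1 hs2
  exact h.fst_eq_of_fst_eq hK hs1 hs2 rfl

/-- In `coeff_mul` everything except `X_x ^ 5` depends on `t` only, and the fifth power is injective
on the reals. -/
theorem IsAdmissible.fderiv_snd_fst_congr (h : IsAdmissible e e' Ω Φ) {p₀ : ℝ × ℝ × ℝ} {ε : ℝ}
    (hK : Metric.ball p₀ ε ⊆ Ω) {P Q : ℝ × ℝ × ℝ} (hP : P ∈ Metric.ball p₀ ε)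
    (hQ : Q ∈ Metric.ball p₀ ε) (hPQ : P.1 = Q.1) :
    (fderiv ℝ Φ P (0, 1, 0)).2.1 = (fderiv ℝ Φ Q (0, 1, 0)).2.1 := by
  have h1 := h.coeff_mul (hK hP)
  have h2 := h.coeff_mul (hK hQ)
  rw [h.fderiv_fst_congr hK hP hQ hPQ, h.fst_eq_of_fst_eq hK hP hQ hPQ, h2, hPQ] at h1
  have h3 := mul_left_cancel₀ (e.β_ne_zero _ (h.2.1 _ (hK hQ)).1) h1
  exact ((by decide : Odd 5).strictMono_pow.injective h3).symm

theorem IsAdmissible.snd_fst_eq (h : IsAdmissible e e' Ω Φ) {p₀ : ℝ × ℝ × ℝ} {ε : ℝ}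
    (hK : Metric.ball p₀ ε ⊆ Ω) {P Q : ℝ × ℝ × ℝ} (hP : P ∈ Metric.ball p₀ ε)
    (hQ : Q ∈ Metric.ball p₀ ε) (hPQ : P.1 = Q.1) :
    (Φ Q).2.1 = (Φ P).2.1 + (fderiv ℝ Φ P (0, 1, 0)).2.1 * (Q.2.1 - P.2.1) := by
  obtain ⟨Z, hZs, hZ, h1⟩ := exists_segment_sub_eq_fderiv (f := fun P => (Φ P).2.1)
    (convex_ball p₀ ε) (fun Z hZ => (h.differentiableAt (hK hZ)).snd.fst) hP hQ
  have h2 := h.fderiv_snd_fst_eq_zero (hK hZ)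
  have h3 := h.fderiv_snd_fst_congr hK hZ hP (fst_eq_of_mem_segment hZs hPQ)
  rw [fderiv_comp_snd_fst (h.differentiableAt (hK hZ)),
    show Q - P = (0, Q.2.1 - P.2.1, (Q - P).2.2) from Prod.ext (by simp [hPQ]) rfl,
    ContinuousLinearMap.apply_triple] at h1
  simp only [zero_smul, zero_add, Prod.snd_add, Prod.smul_snd, Prod.fst_add, Prod.smul_fst, h2, h3,
    mul_zero, add_zero, smul_eq_mul] at h1
  linarith

end admissible

/-! ### The pulled-back equation and its consequences for `U` -/

/-- For a transformation whose first component depends on `t` only and whose second component is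
affine in `x`, the transformed equation in terms of the original variables. -/
theorem holdsAt_transform_iff {e e' : FKdV} {Φ : ℝ × ℝ × ℝ → ℝ × ℝ × ℝ} {u v : ℝ × ℝ → ℝ}
    {q : ℝ × ℝ} {τ ξ a : ℝ} (hΦ : DifferentiableAt ℝ Φ (q.1, q.2, u q))
    (hτ : (fderiv ℝ Φ (q.1, q.2, u q) (1, 0, 0)).1 = τ)
    (hξ : (fderiv ℝ Φ (q.1, q.2, u q) (1, 0, 0)).2.1 = ξ)
    (hT : (fderiv ℝ Φ (q.1, q.2, u q) (0, 0, 1)).1 = 0)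
    (hX : (fderiv ℝ Φ (q.1, q.2, u q) (0, 0, 1)).2.1 = 0) (hτ0 : τ ≠ 0) (ha0 : a ≠ 0)
    (hβ : e'.β (Φ (q.1, q.2, u q)).1 * τ = e.β q.1 * a ^ 5)
    (hsl : ∀ᶠ P in 𝓝 ((q.1, q.2, u q) : ℝ × ℝ × ℝ), P.1 = q.1 →
      (Φ P).1 = (Φ (q.1, q.2, u q)).1 ∧ (Φ P).2.1 = (Φ (q.1, q.2, u q)).2.1 + a * (P.2.1 - q.2))
    (hu : ContDiff ℝ ∞ u) (hv : ContDiff ℝ ∞ v) (ht : IsTransformAt Φ u v q) :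
    e'.HoldsAt v (baseMap Φ u q) ↔
      deriv (fun s => (Φ (s, q.2, u (s, q.2))).2.2) q.1
        + (τ * (Φ (q.1, q.2, u q)).2.2 ^ e'.n - ξ) / a
          * deriv (fun s => (Φ (q.1, s, u (q.1, s))).2.2) q.2
        + e.β q.1 * iteratedDeriv 5 (fun s => (Φ (q.1, s, u (q.1, s))).2.2) q.2 = 0 := by
  set y := baseMap Φ u q with hy
  have hvd : HasFDerivAt v (fderiv ℝ v y) y := (hv.differentiable (by simp) y).hasFDerivAt
  have hgr := hasFDerivAt_graph hΦ (hu.differentiable (by simp) q)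
  have hB : HasFDerivAt (baseMap Φ u) (fderiv ℝ (baseMap Φ u) q) q :=
    (show DifferentiableAt ℝ (baseMap Φ u) q from
      (hgr.fst.prodMk hgr.snd.fst).differentiableAt).hasFDerivAt
  have hBd := fderiv_baseMap_apply hΦ (hu.differentiable (by simp) q)
  have hh : HasFDerivAt (fun r : ℝ × ℝ => (Φ (r.1, r.2, u r)).2.2)
      ((fderiv ℝ v y).comp (fderiv ℝ (baseMap Φ u) q)) q :=
    (hvd.comp q hB).congr_of_eventuallyEq (ht.2.mono fun r hr => hr.symm)
  have h1 : deriv (fun s => (Φ (s, q.2, u (s, q.2))).2.2) q.1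
      = τ * fderiv ℝ v y (1, 0) + ξ * fderiv ℝ v y (0, 1) := by
    rw [hh.deriv_fst.deriv, ContinuousLinearMap.comp_apply, hBd, ContinuousLinearMap.apply_triple]
    simp only [one_smul, zero_smul, add_zero, Prod.fst_add, Prod.smul_fst, Prod.snd_add,
      Prod.smul_snd, hT, hX, hτ, hξ, smul_zero]
    rw [← smul_eq_mul, ← smul_eq_mul, ← map_smul, ← map_smul, ← map_add]
    simp
  have hsl' : ∀ᶠ s in 𝓝 q.2, (Φ (q.1, s, u (q.1, s))).2.2 = v (y.1, y.2 + a * (s - q.2)) := by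
    have hc : Filter.Tendsto (fun s => (q.1, s, u (q.1, s))) (𝓝 q.2) (𝓝 (q.1, q.2, u q)) :=
      (continuous_const.prodMk (continuous_id.prodMk (hu.continuous.comp
        (continuous_const.prodMk continuous_id)))).tendsto q.2
    filter_upwards [hc.eventually hsl, (tendsto_mk_left q).eventually ht.2] with s hs hs'
    obtain ⟨e1, e2⟩ := hs rfl
    rw [← hs']
    simp only [baseMap, e1, e2, hy]
  have hvx : ContDiff ℝ ∞ fun s => v (y.1, s) := hv.comp (contDiff_const.prodMk contDiff_id)
  have hk : ∀ k, iteratedDeriv k (fun s => (Φ (q.1, s, u (q.1, s))).2.2) q.2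
      = a ^ k * iteratedDeriv k (fun s => v (y.1, s)) y.2 := fun k => by
    rw [Filter.EventuallyEq.iteratedDeriv_eq k hsl']
    exact iteratedDeriv_comp_affine hvx k a y.2 q.2
  have hk1 := hk 1
  rw [iteratedDeriv_one, iteratedDeriv_one, pow_one, hvd.deriv_snd.deriv] at hk1
  rw [FKdV.HoldsAt, h1, hk1, hk 5, hvd.deriv_fst.deriv, hvd.deriv_snd.deriv, ht.eq]
  have hβ' : e'.β y.1 * τ = e.β q.1 * a ^ 5 := hβ
  set U := (Φ (q.1, q.2, u q)).2.2
  set A := fderiv ℝ v y (1, 0)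
  set B := fderiv ℝ v y (0, 1)
  set C := iteratedDeriv 5 (fun s => v (y.1, s)) y.2
  -- The pulled-back left-hand side is `τ` times the target one; `hβ` matches the fifth-order terms.
  have : τ * A + ξ * B + (τ * U ^ e'.n - ξ) / a * (a * B) + e.β q.1 * (a ^ 5 * C)
      = τ * (A + U ^ e'.n * B + e'.β y.1 * C) := by
    rw [show (τ * U ^ e'.n - ξ) / a * (a * B) = (τ * U ^ e'.n - ξ) * B by field_simp]
    linear_combination -C * hβ'
  rw [this, mul_eq_zero, or_iff_right hτ0]

/-- The identity on a neighbourhood is one of polynomials. As `n ≥ 2`, the right side has zero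
derivative at 0, which forces `d = 0`; the value at 0 then gives `ξ = 0`, and the values at 1 and 2
give the coefficient and the exponent. -/
theorem eq_of_pow_linear_eq {n n' : ℕ} (hn : 2 ≤ n) (hn' : 2 ≤ n') {τ g a d ξ k₀ : ℝ} (hτ : τ ≠ 0)
    (hg : g ≠ 0) (ha : a ≠ 0) (h : ∀ᶠ k in 𝓝 k₀, τ * (d + g * k) ^ n' = ξ + a * k ^ n) :
    n' = n ∧ d = 0 ∧ ξ = 0 ∧ τ * g ^ n = a := by
  open Polynomial in
  have hP : (C τ * (C d + C g * X) ^ n' : ℝ[X]) = C ξ + C a * X ^ n := by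
    refine Polynomial.eq_of_infinite_eval_eq _ _ ((infinite_of_mem_nhds k₀ h).mono fun k hk => ?_)
    simpa using hk
  have hP' := congrArg (fun P => Polynomial.eval 0 (Polynomial.derivative P)) hP
  have h0 := congrArg (Polynomial.eval 0) hP
  have h1 := congrArg (Polynomial.eval 1) hP
  have h2 := congrArg (Polynomial.eval 2) hP
  have hd : d = 0 := by
    have hn1 : n - 1 ≠ 0 := by omega
    have hn2 : (n' : ℝ) ≠ 0 := by positivity
    simp [Polynomial.derivative_pow, hn1, hτ, hg, hn2] at hP'
    exact hP'.1
  subst hd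
  have hξ : ξ = 0 := by
    simpa [show n ≠ 0 by omega, show n' ≠ 0 by omega, eq_comm] using h0
  subst hξ
  simp only [Polynomial.eval_mul, Polynomial.eval_C, Polynomial.eval_pow, Polynomial.eval_add,
    Polynomial.eval_X, zero_add, mul_one, one_pow, mul_pow] at h1 h2
  have hnn : n' = n := by
    rw [← mul_assoc, h1] at h2
    have := mul_left_cancel₀ ha h2
    exact Nat.pow_right_injective le_rfl (by exact_mod_cast this)
  exact ⟨hnn, rfl, rfl, hnn ▸ h1⟩

section admissible
variable {e e' : FKdV} {Ω : Set (ℝ × ℝ × ℝ)} {Φ : ℝ × ℝ × ℝ → ℝ × ℝ × ℝ}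

/-- The necessary condition on the last component obtained from a function `u`
satisfying the equation at a point. -/
theorem IsAdmissible.condition (h : IsAdmissible e e' Ω Φ) {t x k : ℝ} (hp : (t, x, k) ∈ Ω)
    {u : ℝ × ℝ → ℝ} (hu : ContDiff ℝ ∞ u) (hk : u (t, x) = k) (hH : e.HoldsAt u (t, x)) :
    deriv (fun s => (Φ (s, x, u (s, x))).2.2) t
        + ((fderiv ℝ Φ (t, x, k) (1, 0, 0)).1 * (Φ (t, x, k)).2.2 ^ e'.n
            - (fderiv ℝ Φ (t, x, k) (1, 0, 0)).2.1) / (fderiv ℝ Φ (t, x, k) (0, 1, 0)).2.1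
          * deriv (fun s => (Φ (t, s, u (t, s))).2.2) x
        + e.β t * iteratedDeriv 5 (fun s => (Φ (t, s, u (t, s))).2.2) x = 0 := by
  obtain ⟨hT2, hT3⟩ := h.fderiv_fst_eq_zero hp
  have hX3 := h.fderiv_snd_fst_eq_zero hp
  have hτ := h.fderiv_fst_ne_zero hp
  have ha := (h.fderiv_diag_ne_zero hp).1
  have hβ := h.coeff_mul hp
  obtain ⟨v, hv, ht, hi⟩ := h.exists_transform hu (q := (t, x)) (by rw [hk]; exact hp) rfl rfl (by
    rw [hk, ContinuousLinearMap.apply_triple, ContinuousLinearMap.apply_triple _ 0 1 (fderiv ℝ u (t, x) (0, 1))]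
    simp only [one_smul, zero_smul, add_zero, zero_add, Prod.fst_add, Prod.smul_fst, Prod.snd_add,
      Prod.smul_snd, hT2, hT3, hX3, smul_zero, mul_zero, sub_zero]
    exact mul_ne_zero hτ ha)
  have := (holdsAt_transform_iff (e := e) (e' := e') (q := (t, x)) (u := u)
    (a := (fderiv ℝ Φ (t, x, k) (0, 1, 0)).2.1)
    (by rw [hk]; exact h.differentiableAt hp) rfl rfl (by rw [hk]; exact hT3)
    (by rw [hk]; exact hX3) (by rw [hk]; exact hτ) ha (by rw [hk]; exact hβ) (by
      rw [hk]
      obtain ⟨ε, hε, hK⟩ := Metric.isOpen_iff.1 h.1.1 _ hp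
      filter_upwards [Metric.ball_mem_nhds _ hε] with P hP hP1
      have hpK := Metric.mem_ball_self (x := (t, x, k)) hε
      exact ⟨h.fst_eq_of_fst_eq hK hP hpK hP1, h.snd_fst_eq hK hpK hP hP1.symm⟩) hu hv ht).1 (hi.1 hH)
  rw [hk] at this
  exact this

theorem IsAdmissible.differentiableAt_fderiv (h : IsAdmissible e e' Ω Φ) {p : ℝ × ℝ × ℝ}
    (hp : p ∈ Ω) (d : ℝ × ℝ × ℝ) : DifferentiableAt ℝ (fun P => (fderiv ℝ Φ P d).2.2) p :=
  ((((h.contDiffAt hp).fderiv_right (m := ∞) (by simp)).clm_apply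
    contDiffAt_const).differentiableAt (by simp)).snd.snd

theorem IsAdmissible.contDiffAt_slice (h : IsAdmissible e e' Ω Φ) {t x k : ℝ} (hp : (t, x, k) ∈ Ω)
    {u : ℝ × ℝ → ℝ} (hu : ContDiff ℝ ∞ u) (hk : u (t, x) = k) :
    ContDiffAt ℝ ∞ (fun s => (Φ (t, s, u (t, s))).2.2) x := by
  have h1 : ContDiffAt ℝ ∞ Φ (t, x, u (t, x)) := by rw [hk]; exact h.contDiffAt hp
  exact (ContDiffAt.comp x (f := fun s => (t, s, u (t, s))) h1
    (contDiff_const.prodMk (contDiff_id.prodMk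
      (hu.comp (contDiff_const.prodMk contDiff_id)))).contDiffAt).snd.snd

/-- Adding `(x - x₀)^4` to `u` does not affect the source equation at the point, but changes `U` by
about `U_u (x - x₀)^4`, whose fifth derivative is `120 D_x U_u`. -/
theorem IsAdmissible.fderiv_fderiv_eq_zero_of_snd (h : IsAdmissible e e' Ω Φ) {p : ℝ × ℝ × ℝ}
    (hp : p ∈ Ω) (r : ℝ) : fderiv ℝ (fun P => (fderiv ℝ Φ P (0, 0, 1)).2.2) p (0, 1, r) = 0 := by
  obtain ⟨ε, hε, hK⟩ := Metric.isOpen_iff.1 h.1.1 p hp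
  have hgd := (h.differentiableAt_fderiv hp (0, 0, 1)).hasFDerivAt
  obtain ⟨t, x, k⟩ := p
  set g : ℝ × ℝ × ℝ → ℝ := fun P => (fderiv ℝ Φ P (0, 0, 1)).2.2
  set u₁ := jetPoly (t, x) k (-(k ^ e.n * r)) r 0 0 0
  set u₂ := jetPoly (t, x) k (-(k ^ e.n * r)) r 1 0 0
  have hu₁ : ContDiff ℝ ∞ u₁ := contDiff_jetPoly ..
  have hu₂ : ContDiff ℝ ∞ u₂ := contDiff_jetPoly ..
  have hk₁ : u₁ (t, x) = k := jetPoly_self ..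
  have hk₂ : u₂ (t, x) = k := jetPoly_self ..
  have c₁ := h.condition hp hu₁ hk₁ ((holdsAt_jetPoly ..).2 (by ring))
  have c₂ := h.condition hp hu₂ hk₂ ((holdsAt_jetPoly ..).2 (by ring))
  have ht : (fun s => (Φ (s, x, u₂ (s, x))).2.2) = fun s => (Φ (s, x, u₁ (s, x))).2.2 := by
    funext s; simp [u₁, u₂, jetPoly]
  have hs₁ := h.contDiffAt_slice hp hu₁ hk₁
  have hs₂ := h.contDiffAt_slice hp hu₂ hk₂
  set h₁ := fun s => (Φ (t, s, u₁ (t, s))).2.2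
  set h₂ := fun s => (Φ (t, s, u₂ (t, s))).2.2
  have hw : ∀ s, u₂ (t, s) = u₁ (t, s) + (s - x) ^ 4 := fun s => by
    simp only [u₁, u₂, jetPoly]; ring
  -- The mean value point depends on `s` with no known regularity. Boundedness of `θ` is enough, as
  -- it is multiplied by `(s - x)^4` and does not influence the derivative at `x`.
  have hex : ∀ s, ∃ θ ∈ Set.Icc (0 : ℝ) 1, (t, s, u₁ (t, s)) ∈ Metric.ball (t, x, k) ε →
      (t, s, u₂ (t, s)) ∈ Metric.ball (t, x, k) ε →
      h₂ s - h₁ s = g (t, s, u₁ (t, s) + θ * (s - x) ^ 4) * (s - x) ^ 4 := by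
    intro s
    by_cases hs : (t, s, u₁ (t, s)) ∈ Metric.ball (t, x, k) ε ∧
      (t, s, u₂ (t, s)) ∈ Metric.ball (t, x, k) ε
    · obtain ⟨Z, hZs, hZ, hd⟩ := exists_segment_sub_eq_fderiv (f := fun P => (Φ P).2.2)
        (convex_ball _ ε) (fun Z hZ => (h.differentiableAt (hK hZ)).snd.snd) hs.1 hs.2
      rw [segment_eq_image'] at hZs
      obtain ⟨θ, hθ, rfl⟩ := hZs
      refine ⟨θ, hθ, fun _ _ => ?_⟩
      have e1 : ((t, s, u₂ (t, s)) : ℝ × ℝ × ℝ) - (t, s, u₁ (t, s)) = (s - x) ^ 4 • (0, 0, 1) := by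
        simp [hw]
      rw [fderiv_comp_snd_snd (h.differentiableAt (hK hZ)), e1, map_smul] at hd
      simp only [Prod.smul_snd, smul_eq_mul, Prod.smul_mk, mul_zero, mul_one, Prod.mk_add_mk,
        add_zero] at hd
      rw [mul_comm]
      exact hd
    · exact ⟨0, by simp, fun a b => absurd ⟨a, b⟩ hs⟩
  choose θ hθ hθ' using hex
  have hZd : HasDerivAt (fun s => (t, s, u₁ (t, s) + θ s * (s - x) ^ 4)) (0, 1, r) x := by
    have hz : HasDerivAt (fun s => θ s * (s - x) ^ 4) 0 x := by
      rw [hasDerivAt_iff_isLittleO]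
      simp only [sub_self, ne_eq, OfNat.ofNat_ne_zero, not_false_eq_true, zero_pow, mul_zero,
        smul_zero, sub_zero]
      have hO : (fun s => θ s * (s - x) ^ 4) =O[𝓝 x] fun s => (s - x) ^ 4 := by
        refine IsBigO.of_bound 1 (.of_forall fun s => ?_)
        rw [norm_mul]
        gcongr
        rw [Real.norm_eq_abs, abs_of_nonneg (hθ s).1]
        exact (hθ s).2
      refine hO.trans_isLittleO ?_
      have h3 : (fun s : ℝ => (s - x) ^ 3) =o[𝓝 x] fun _ => (1 : ℝ) := by
        rw [isLittleO_one_iff]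
        have : Continuous fun s : ℝ => (s - x) ^ 3 := by fun_prop
        simpa using this.tendsto x
      exact (h3.mul_isBigO (isBigO_refl (fun s => s - x) _)).congr (fun s => by ring)
        fun s => by ring
    have h4 := (hasDerivAt_jetPoly_snd (t, x) k (-(k ^ e.n * r)) r 0 0 0).add hz
    rw [add_zero] at h4
    exact (hasDerivAt_const x t).prodMk ((hasDerivAt_id x).prodMk h4)
  have hZx : ((t, x, u₁ (t, x) + θ x * (x - x) ^ 4) : ℝ × ℝ × ℝ) = (t, x, k) := by simp [hk₁]
  have hgZ : HasDerivAt (fun s => g (t, s, u₁ (t, s) + θ s * (s - x) ^ 4))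
      (fderiv ℝ g (t, x, k) (0, 1, r)) x := by
    have hgd' : HasFDerivAt g (fderiv ℝ g (t, x, k)) (t, x, u₁ (t, x) + θ x * (x - x) ^ 4) := by
      rw [hZx]; exact hgd
    exact hgd'.comp_hasDerivAt x hZd
  have hball : ∀ u : ℝ × ℝ → ℝ, ContDiff ℝ ∞ u → u (t, x) = k →
      ∀ᶠ s in 𝓝 x, (t, s, u (t, s)) ∈ Metric.ball (t, x, k) ε := fun u hu hk => by
    have hc : Continuous fun s => (t, s, u (t, s)) :=
      continuous_const.prodMk (continuous_id.prodMk (hu.continuous.comp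
        (continuous_const.prodMk continuous_id)))
    refine hc.continuousAt.eventually (Metric.isOpen_ball.mem_nhds ?_)
    simpa only [hk] using Metric.mem_ball_self hε
  have hlo := hgZ.isLittleO
  rw [hZx] at hlo
  have hfin := iteratedDeriv_of_isLittleO (f := fun s => h₂ s - h₁ s) (x₀ := x)
    (α := g (t, x, k)) (γ := fderiv ℝ g (t, x, k) (0, 1, r))
    (by exact_mod_cast (contDiffAt_infty.1 (hs₂.sub hs₁) 5)) (by
      refine (hlo.mul_isBigO (isBigO_refl (fun s => (s - x) ^ 4) _)).congr' ?_
        (.of_forall fun s => by ring)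
      filter_upwards [hball u₁ hu₁ hk₁, hball u₂ hu₂ hk₂] with s hs1 hs2
      rw [hθ' s hs1 hs2, smul_eq_mul]
      ring)
  obtain ⟨f5, f1⟩ := hfin
  rw [iteratedDeriv_fun_sub (by exact_mod_cast (contDiffAt_infty.1 hs₂ 5))
    (by exact_mod_cast (contDiffAt_infty.1 hs₁ 5))] at f5
  rw [deriv_fun_sub (hs₂.differentiableAt (by simp)) (hs₁.differentiableAt (by simp))] at f1
  rw [ht] at c₂
  have hβ : e.β t ≠ 0 := e.β_ne_zero t (h.2.1 _ hp).1
  rw [sub_eq_zero] at f1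
  rw [f1] at c₂
  have : e.β t * (120 * fderiv ℝ g (t, x, k) (0, 1, r)) = 0 := by
    rw [← f5]; linear_combination c₂ - c₁
  simpa [hβ] using this

end admissible

/-! ### Solving the determining equations locally -/

section admissible
variable {e e' : FKdV} {Ω : Set (ℝ × ℝ × ℝ)} {Φ : ℝ × ℝ × ℝ → ℝ × ℝ × ℝ}

theorem IsAdmissible.fderiv_snd_snd_congr (h : IsAdmissible e e' Ω Φ) {p₀ : ℝ × ℝ × ℝ} {ε : ℝ}
    (hK : Metric.ball p₀ ε ⊆ Ω) {P Q : ℝ × ℝ × ℝ} (hP : P ∈ Metric.ball p₀ ε)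
    (hQ : Q ∈ Metric.ball p₀ ε) (hPQ : P.1 = Q.1) :
    (fderiv ℝ Φ P (0, 0, 1)).2.2 = (fderiv ℝ Φ Q (0, 0, 1)).2.2 := by
  obtain ⟨Z, -, hZ, h1⟩ := exists_segment_sub_eq_fderiv
    (f := fun P => (fderiv ℝ Φ P (0, 0, 1)).2.2) (convex_ball p₀ ε)
    (fun Z hZ => h.differentiableAt_fderiv (hK hZ) _) hP hQ
  have h2 := h.fderiv_fderiv_eq_zero_of_snd (hK hZ) 0
  have h3 := h.fderiv_fderiv_eq_zero_of_snd (hK hZ) 1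
  generalize fderiv ℝ (fun P => (fderiv ℝ Φ P (0, 0, 1)).2.2) Z = G at h1 h2 h3
  rw [G.apply_triple, h2] at h3
  rw [show Q - P = (0, (Q - P).2.1, (Q - P).2.2) from Prod.ext (by simp [hPQ]) rfl,
    G.apply_triple, h2] at h1
  simp only [smul_eq_mul, zero_mul, one_mul, mul_zero, zero_add] at h1 h3
  rw [h3, mul_zero] at h1
  linarith

theorem IsAdmissible.snd_snd_eq (h : IsAdmissible e e' Ω Φ) {p₀ : ℝ × ℝ × ℝ} {ε : ℝ}
    (hK : Metric.ball p₀ ε ⊆ Ω) {P Q : ℝ × ℝ × ℝ} (hP : P ∈ Metric.ball p₀ ε)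
    (hQ : Q ∈ Metric.ball p₀ ε) (h₁ : P.1 = Q.1) (h₂ : P.2.1 = Q.2.1) :
    (Φ Q).2.2 = (Φ P).2.2 + (fderiv ℝ Φ P (0, 0, 1)).2.2 * (Q.2.2 - P.2.2) := by
  obtain ⟨Z, hZs, hZ, h3⟩ := exists_segment_sub_eq_fderiv (f := fun P => (Φ P).2.2)
    (convex_ball p₀ ε) (fun Z hZ => (h.differentiableAt (hK hZ)).snd.snd) hP hQ
  have h4 := h.fderiv_snd_snd_congr hK hZ hP (fst_eq_of_mem_segment hZs h₁)
  rw [fderiv_comp_snd_snd (h.differentiableAt (hK hZ)),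
    show Q - P = (Q.2.2 - P.2.2) • (0, 0, 1) from Prod.ext (by simp [h₁]) (by ext <;> simp [h₂]),
    map_smul] at h3
  simp only [Prod.smul_snd, h4, smul_eq_mul] at h3
  linarith

/-- Freezes `X_t` while `u` varies, so that the classifying equation becomes a polynomial identity
in `u`. -/
theorem IsAdmissible.fderiv_time_congr (h : IsAdmissible e e' Ω Φ) {p₀ : ℝ × ℝ × ℝ} {ε : ℝ}
    (hK : Metric.ball p₀ ε ⊆ Ω) {P Q : ℝ × ℝ × ℝ} (hP : P ∈ Metric.ball p₀ ε)
    (hQ : Q ∈ Metric.ball p₀ ε) (h₁ : P.1 = Q.1) (h₂ : P.2.1 = Q.2.1) :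
    (fderiv ℝ Φ P (1, 0, 0)).2.1 = (fderiv ℝ Φ Q (1, 0, 0)).2.1 := by
  have d1 : HasDerivAt (fun s => (Φ (s, P.2)).2.1) (fderiv ℝ Φ P (1, 0, 0)).2.1 P.1 :=
    hasDerivAt_slice_fst (f := fun P => (Φ P).2.1)
      (h.differentiableAt (hK hP)).hasFDerivAt.snd.fst
  have d2 : HasDerivAt (fun s => (Φ (s, Q.2)).2.1) (fderiv ℝ Φ Q (1, 0, 0)).2.1 Q.1 :=
    hasDerivAt_slice_fst (f := fun P => (Φ P).2.1)
      (h.differentiableAt (hK hQ)).hasFDerivAt.snd.fst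
  rw [← h₁] at d2
  refine d1.unique (d2.congr_of_eventuallyEq ?_)
  have hc : ∀ Z : ℝ × ℝ × ℝ, Z ∈ Metric.ball p₀ ε → Z.1 = P.1 →
      ∀ᶠ s in 𝓝 P.1, (s, Z.2) ∈ Metric.ball p₀ ε := by
    intro Z hZ hZP
    refine (by fun_prop : Continuous fun s : ℝ => (s, Z.2)).continuousAt.eventually
      (Metric.isOpen_ball.mem_nhds ?_)
    rw [← hZP]; exact hZ
  filter_upwards [hc P hP rfl, hc Q hQ h₁.symm] with s hs1 hs2
  rw [h.snd_fst_eq hK hs2 hs1 rfl]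
  simp [h₂]

/-- Subtracting the conditions for the jets with `(u_t, u_x) = (0, 0)` and `(-u^n, 1)`. The terms
`U_t` and `U_x` cancel, leaving a multiple of `U_u ≠ 0`. -/
theorem IsAdmissible.classifying_equation (h : IsAdmissible e e' Ω Φ) {p : ℝ × ℝ × ℝ}
    (hp : p ∈ Ω) : (fderiv ℝ Φ p (1, 0, 0)).1 * (Φ p).2.2 ^ e'.n
      = (fderiv ℝ Φ p (1, 0, 0)).2.1 + (fderiv ℝ Φ p (0, 1, 0)).2.1 * p.2.2 ^ e.n := by
  obtain ⟨ε, hε, hK⟩ := Metric.isOpen_iff.1 h.1.1 p hp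
  obtain ⟨ha, hg⟩ := h.fderiv_diag_ne_zero hp
  have hpK := Metric.mem_ball_self (x := p) hε
  obtain ⟨t, x, k⟩ := p
  set u₁ := jetPoly (t, x) k 0 0 0 0 0
  set u₂ := jetPoly (t, x) k (-k ^ e.n) 1 0 0 0
  have hu₁ : ContDiff ℝ ∞ u₁ := contDiff_jetPoly ..
  have hu₂ : ContDiff ℝ ∞ u₂ := contDiff_jetPoly ..
  have hk₁ : u₁ (t, x) = k := jetPoly_self ..
  have hk₂ : u₂ (t, x) = k := jetPoly_self ..
  have c₁ := h.condition hp hu₁ hk₁ ((holdsAt_jetPoly ..).2 (by ring))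
  have c₂ := h.condition hp hu₂ hk₂ ((holdsAt_jetPoly ..).2 (by ring))
  have hgr₁ := (hasFDerivAt_graph (q := (t, x)) (by rw [hk₁]; exact h.differentiableAt hp)
    (hu₁.differentiable (by simp) _)).snd.snd
  have hgr₂ := (hasFDerivAt_graph (q := (t, x)) (by rw [hk₂]; exact h.differentiableAt hp)
    (hu₂.differentiable (by simp) _)).snd.snd
  have t₁ := hgr₁.deriv_fst.deriv
  have t₂ := hgr₂.deriv_fst.deriv
  have x₁ := hgr₁.deriv_snd.deriv
  have x₂ := hgr₂.deriv_snd.deriv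
  simp only [ContinuousLinearMap.comp_apply, ContinuousLinearMap.prod_apply,
    ContinuousLinearMap.coe_fst', ContinuousLinearMap.coe_snd', u₁, u₂, fderiv_jetPoly_fst,
    fderiv_jetPoly_snd, jetPoly_self] at t₁ t₂ x₁ x₂
  rw [ContinuousLinearMap.apply_triple] at t₁ t₂ x₁ x₂
  have hev : ∀ u : ℝ × ℝ → ℝ, ContDiff ℝ ∞ u → u (t, x) = k →
      ∀ᶠ s in 𝓝 x, (t, s, u (t, s)) ∈ Metric.ball (t, x, k) ε := fun u hu hk => by
    have hc : Continuous fun s => (t, s, u (t, s)) :=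
      continuous_const.prodMk (continuous_id.prodMk (hu.continuous.comp
        (continuous_const.prodMk continuous_id)))
    refine hc.continuousAt.eventually (Metric.isOpen_ball.mem_nhds ?_)
    simpa only [hk] using Metric.mem_ball_self hε
  have hdiff : ∀ᶠ s in 𝓝 x, (Φ (t, s, u₂ (t, s))).2.2 - (Φ (t, s, u₁ (t, s))).2.2
      = (fderiv ℝ Φ (t, x, k) (0, 0, 1)).2.2 * (s - x) ^ 1 := by
    filter_upwards [hev u₁ hu₁ hk₁, hev u₂ hu₂ hk₂] with s hs1 hs2
    rw [h.snd_snd_eq hK hs1 hs2 rfl rfl, h.fderiv_snd_snd_congr hK hs1 hpK rfl]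
    simp only [u₁, u₂, jetPoly]
    ring
  -- Since `U` is affine in `u` with slope depending on `t` only, the difference is linear in `s`
  -- and the fifth derivatives agree.
  have h5 := Filter.EventuallyEq.iteratedDeriv_eq 5 hdiff
  rw [iteratedDeriv_const_mul_field, iteratedDeriv_sub_const_pow, iteratedDeriv_fun_sub
    (by exact_mod_cast (contDiffAt_infty.1 (h.contDiffAt_slice hp hu₂ hk₂) 5))
    (by exact_mod_cast (contDiffAt_infty.1 (h.contDiffAt_slice hp hu₁ hk₁) 5))] at h5
  norm_num [Nat.descFactorial] at h5
  simp only [u₁, u₂] at c₁ c₂ h5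
  rw [t₁, x₁] at c₁
  rw [t₂, x₂, sub_eq_zero.1 h5] at c₂
  simp only [one_smul, zero_smul, add_zero, zero_add, Prod.snd_add, Prod.smul_snd,
    smul_eq_mul] at c₁ c₂
  have key := sub_eq_zero.2 (c₂.trans c₁.symm)
  rw [← sub_eq_zero]
  refine (mul_eq_zero.1 (?_ : (fderiv ℝ Φ (t, x, k) (0, 0, 1)).2.2 * _ = 0)).resolve_left hg
  field_simp at key
  linear_combination key

/-- The exponents agree, and at every point the transformation has the derivative of a
transformation of the group. -/
theorem IsAdmissible.pointwise (h : IsAdmissible e e' Ω Φ) {p : ℝ × ℝ × ℝ} (hp : p ∈ Ω) :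
    e'.n = e.n ∧ (Φ p).2.2 = (fderiv ℝ Φ p (0, 0, 1)).2.2 * p.2.2 ∧
    (fderiv ℝ Φ p (1, 0, 0)).2.1 = 0 ∧
    (fderiv ℝ Φ p (1, 0, 0)).1 * (fderiv ℝ Φ p (0, 0, 1)).2.2 ^ e.n
      = (fderiv ℝ Φ p (0, 1, 0)).2.1 := by
  obtain ⟨ε, hε, hK⟩ := Metric.isOpen_iff.1 h.1.1 p hp
  obtain ⟨ha, hg⟩ := h.fderiv_diag_ne_zero hp
  have hpK := Metric.mem_ball_self (x := p) hε
  have hev : ∀ᶠ k in 𝓝 p.2.2, (p.1, p.2.1, k) ∈ Metric.ball p ε :=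
    (by fun_prop : Continuous fun k : ℝ => (p.1, p.2.1, k)).continuousAt.eventually
      (Metric.ball_mem_nhds p hε)
  obtain ⟨h1, h2, h3, h4⟩ := eq_of_pow_linear_eq (τ := (fderiv ℝ Φ p (1, 0, 0)).1)
    (g := (fderiv ℝ Φ p (0, 0, 1)).2.2) (a := (fderiv ℝ Φ p (0, 1, 0)).2.1)
    (d := (Φ p).2.2 - (fderiv ℝ Φ p (0, 0, 1)).2.2 * p.2.2)
    (ξ := (fderiv ℝ Φ p (1, 0, 0)).2.1) (k₀ := p.2.2) e.two_le_n e'.two_le_n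
    (h.fderiv_fst_ne_zero hp) hg ha (by
      filter_upwards [hev] with k hk
      have h5 := h.classifying_equation (hK hk)
      rw [h.snd_snd_eq hK hpK hk rfl rfl, h.fderiv_time_congr hK hk hpK rfl rfl,
        h.fderiv_fst_congr hK hk hpK rfl, h.fderiv_snd_fst_congr hK hk hpK rfl] at h5
      rw [← h5]
      congr 2
      ring)
  exact ⟨h1, by linarith, h3, h4⟩

/-- Constants solve the source equation, and on them `U = g(t) u` has no `x`-dependence, so the
condition reduces to `U_t = 0`. -/
theorem IsAdmissible.fderiv_snd_snd_eq_zero (h : IsAdmissible e e' Ω Φ) {p : ℝ × ℝ × ℝ}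
    (hp : p ∈ Ω) : (fderiv ℝ Φ p (1, 0, 0)).2.2 = 0 ∧ (fderiv ℝ Φ p (0, 1, 0)).2.2 = 0 := by
  obtain ⟨ε, hε, hK⟩ := Metric.isOpen_iff.1 h.1.1 p hp
  have hpK := Metric.mem_ball_self (x := p) hε
  obtain ⟨t, x, k⟩ := p
  have hev : ∀ᶠ s in 𝓝 x, (Φ (t, s, k)).2.2 = (fderiv ℝ Φ (t, x, k) (0, 0, 1)).2.2 * k := by
    filter_upwards [(by fun_prop : Continuous fun s : ℝ => (t, s, k)).continuousAt.eventually
      (Metric.ball_mem_nhds (t, x, k) hε)] with s hs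
    rw [(h.pointwise (hK hs)).2.1, h.fderiv_snd_snd_congr hK hs hpK rfl]
  have c := h.condition hp (u := fun _ => k) contDiff_const rfl
    (by simp [FKdV.HoldsAt, iteratedDeriv_const])
  have hgr := (hasFDerivAt_graph (q := (t, x)) (u := fun _ => k) (h.differentiableAt hp)
    (differentiableAt_const _)).snd.snd
  have ht := hgr.deriv_fst.deriv
  have hx := hgr.deriv_snd.deriv
  simp only [ContinuousLinearMap.comp_apply, ContinuousLinearMap.prod_apply,
    ContinuousLinearMap.coe_fst', ContinuousLinearMap.coe_snd', fderiv_fun_const] at ht hx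
  have hx0 : deriv (fun s => (Φ (t, s, k)).2.2) x = 0 := by
    rw [Filter.EventuallyEq.deriv_eq hev, deriv_const]
  rw [Filter.EventuallyEq.iteratedDeriv_eq 5 hev, iteratedDeriv_const, hx0] at c
  rw [ht] at c
  exact ⟨by simpa using c, hx.symm.trans hx0⟩

theorem IsAdmissible.eventually_eq (h : IsAdmissible e e' Ω Φ) {p : ℝ × ℝ × ℝ} (hp : p ∈ Ω) :
    ∃ δ₁ δ₂ δ₃ δ₄ κ : ℝ, δ₁ ≠ 0 ∧ δ₃ ≠ 0 ∧ κ ^ e.n = δ₁ / δ₃ ∧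
      ∀ᶠ P in 𝓝 p, Φ P = (δ₃ * P.1 + δ₄, δ₁ * P.2.1 + δ₂, κ * P.2.2) ∧
        e'.β (Φ P).1 = δ₁ ^ 5 / δ₃ * e.β P.1 := by
  obtain ⟨ε, hε, hK⟩ := Metric.isOpen_iff.1 h.1.1 p hp
  have hpK := Metric.mem_ball_self (x := p) hε
  have ha := (h.fderiv_diag_ne_zero hp).1
  have hg := (h.fderiv_diag_ne_zero hp).2
  have hτ := h.fderiv_fst_ne_zero hp
  set τ := (fderiv ℝ Φ p (1, 0, 0)).1 with hτd
  set a := (fderiv ℝ Φ p (0, 1, 0)).2.1 with had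
  set g := (fderiv ℝ Φ p (0, 0, 1)).2.2 with hgd
  have hτa : τ * g ^ e.n = a := (h.pointwise hp).2.2.2
  have hU : ∀ P ∈ Metric.ball p ε, (Φ P).2.2 = g * P.2.2 := by
    intro P hP
    have hQ : (p.1, p.2.1, P.2.2) ∈ Metric.ball p ε := by
      simp only [Metric.mem_ball, Prod.dist_eq, max_lt_iff, dist_self] at hP ⊢
      exact ⟨hε, hε, hP.2.2⟩
    obtain ⟨Z, -, hZ, h1⟩ := exists_segment_sub_eq_fderiv (f := fun P => (Φ P).2.2)
      (convex_ball p ε) (fun Z hZ => (h.differentiableAt (hK hZ)).snd.snd) hQ hP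
    obtain ⟨z1, z2⟩ := h.fderiv_snd_snd_eq_zero (hK hZ)
    rw [fderiv_comp_snd_snd (h.differentiableAt (hK hZ)),
      show P - (p.1, p.2.1, P.2.2) = (P.1 - p.1, P.2.1 - p.2.1, 0) by ext <;> simp,
      ContinuousLinearMap.apply_triple, zero_smul, add_zero, Prod.snd_add, Prod.snd_add,
      Prod.smul_snd, Prod.smul_snd, Prod.smul_snd, Prod.smul_snd, z1, z2, smul_zero, smul_zero,
      add_zero, (h.pointwise (hK hQ)).2.1, h.fderiv_snd_snd_congr hK hQ hpK rfl] at h1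
    linarith
  have hX : ∀ P ∈ Metric.ball p ε, (Φ P).2.1 = (Φ p).2.1 + a * (P.2.1 - p.2.1) := by
    intro P hP
    have hQ : (p.1, P.2) ∈ Metric.ball p ε := mk_mem_ball hpK hP
    obtain ⟨Z, -, hZ, h1⟩ := exists_segment_sub_eq_fderiv (f := fun P => (Φ P).2.1)
      (convex_ball p ε) (fun Z hZ => (h.differentiableAt (hK hZ)).snd.fst) hQ hP
    rw [fderiv_comp_snd_fst (h.differentiableAt (hK hZ)),
      show P - (p.1, P.2) = (P.1 - p.1) • (1, 0, 0) by ext <;> simp, map_smul, Prod.smul_snd,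
      Prod.smul_fst, (h.pointwise (hK hZ)).2.2.1, smul_zero, h.snd_fst_eq hK hpK hQ rfl] at h1
    exact sub_eq_zero.1 h1
  have hXZ : ∀ Z ∈ Metric.ball p ε, (fderiv ℝ Φ Z (0, 1, 0)).2.1 = a := by
    intro Z hZ
    have h1 : HasFDerivAt (fun P : ℝ × ℝ × ℝ => (Φ p).2.1 + a * (P.2.1 - p.2.1)) _ Z :=
      (((hasFDerivAt_snd (𝕜 := ℝ) (p := Z)).fst.sub_const p.2.1).const_mul a).const_add (Φ p).2.1
    rw [← fderiv_comp_snd_fst (h.differentiableAt (hK hZ)), Filter.EventuallyEq.fderiv_eq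
      (Filter.eventually_of_mem (Metric.isOpen_ball.mem_nhds hZ) hX), h1.fderiv]
    simp
  have hUZ : ∀ Z ∈ Metric.ball p ε, (fderiv ℝ Φ Z (0, 0, 1)).2.2 = g := by
    intro Z hZ
    have h1 : HasFDerivAt (fun P : ℝ × ℝ × ℝ => g * P.2.2) _ Z :=
      (hasFDerivAt_snd (𝕜 := ℝ) (p := Z)).snd.const_mul g
    rw [← fderiv_comp_snd_snd (h.differentiableAt (hK hZ)), Filter.EventuallyEq.fderiv_eq
      (Filter.eventually_of_mem (Metric.isOpen_ball.mem_nhds hZ) hU), h1.fderiv]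
    simp
  -- `T_t` is constant because `T_t g^n = X_x`, with `g` and `X_x` already constant on the ball.
  have hTZ : ∀ Z ∈ Metric.ball p ε, (fderiv ℝ Φ Z (1, 0, 0)).1 = τ := by
    intro Z hZ
    have h1 := (h.pointwise (hK hZ)).2.2.2
    rw [hUZ Z hZ, hXZ Z hZ, ← hτa] at h1
    exact mul_right_cancel₀ (pow_ne_zero _ hg) h1
  have hT : ∀ P ∈ Metric.ball p ε, (Φ P).1 = (Φ p).1 + τ * (P.1 - p.1) := by
    intro P hP
    obtain ⟨Z, -, hZ, h1⟩ := exists_segment_sub_eq_fderiv (f := fun P => (Φ P).1)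
      (convex_ball p ε) (fun Z hZ => (h.differentiableAt (hK hZ)).fst) hpK hP
    obtain ⟨z1, z2⟩ := h.fderiv_fst_eq_zero (hK hZ)
    rw [fderiv_comp_fst (h.differentiableAt (hK hZ)),
      show P - p = (P.1 - p.1, P.2.1 - p.2.1, P.2.2 - p.2.2) from rfl,
      ContinuousLinearMap.apply_triple, Prod.fst_add, Prod.fst_add, Prod.smul_fst, Prod.smul_fst,
      Prod.smul_fst, z1, z2, hTZ Z hZ] at h1
    simp only [smul_eq_mul, mul_zero, add_zero] at h1
    linarith
  refine ⟨a, (Φ p).2.1 - a * p.2.1, τ, (Φ p).1 - τ * p.1, g, ha, hτ, ?_, ?_⟩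
  · rw [← hτa, mul_div_cancel_left₀ _ hτ]
  · filter_upwards [Metric.ball_mem_nhds p hε] with P hP
    refine ⟨Prod.ext ?_ (Prod.ext ?_ (hU P hP)), ?_⟩
    · rw [hT P hP]; ring
    · rw [hX P hP]; ring
    · have h1 := h.coeff_mul (hK hP)
      rw [hTZ P hP, hXZ P hP] at h1
      field_simp
      linarith

end admissible

/-! ### Uniqueness of the parameters and the global form -/

theorem eq_of_eventually_affine_eq {a b a' b' s₀ : ℝ}
    (h : ∀ᶠ s in 𝓝 s₀, a * s + b = a' * s + b') : a = a' ∧ b = b' := by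
  have h1 : ∀ a b : ℝ, HasDerivAt (fun s => a * s + b) a s₀ := fun a b =>
    (((hasDerivAt_id s₀).const_mul a).add_const b).congr_deriv (mul_one a)
  have ha : a = a' := (h1 a b).unique ((h1 a' b').congr_of_eventuallyEq h)
  subst ha
  exact ⟨rfl, add_left_cancel h.self_of_nhds⟩

theorem eq_of_eventually_linear_eq {a a' s₀ : ℝ} (h : ∀ᶠ s in 𝓝 s₀, a * s = a' * s) : a = a' :=
  (eq_of_eventually_affine_eq (b := 0) (b' := 0) (by simpa using h)).1

theorem eq_of_eventually_affineTriple_eq {a₁ a₂ a₃ a₄ k b₁ b₂ b₃ b₄ l : ℝ} {p : ℝ × ℝ × ℝ}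
    (h : ∀ᶠ P in 𝓝 p, ((a₃ * P.1 + a₄, a₁ * P.2.1 + a₂, k * P.2.2) : ℝ × ℝ × ℝ)
      = (b₃ * P.1 + b₄, b₁ * P.2.1 + b₂, l * P.2.2)) :
    a₁ = b₁ ∧ a₂ = b₂ ∧ a₃ = b₃ ∧ a₄ = b₄ ∧ k = l := by
  simp only [Prod.mk.injEq] at h
  have c1 : Filter.Tendsto (fun s : ℝ => (s, p.2)) (𝓝 p.1) (𝓝 p) :=
    (by fun_prop : Continuous fun s : ℝ => (s, p.2)).tendsto p.1
  have c2 : Filter.Tendsto (fun s : ℝ => (p.1, s, p.2.2)) (𝓝 p.2.1) (𝓝 p) :=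
    (by fun_prop : Continuous fun s : ℝ => (p.1, s, p.2.2)).tendsto p.2.1
  have c3 : Filter.Tendsto (fun s : ℝ => (p.1, p.2.1, s)) (𝓝 p.2.2) (𝓝 p) :=
    (by fun_prop : Continuous fun s : ℝ => (p.1, p.2.1, s)).tendsto p.2.2
  obtain ⟨e3, e4⟩ := eq_of_eventually_affine_eq ((c1.eventually h).mono fun s hs => hs.1)
  obtain ⟨e1, e2⟩ := eq_of_eventually_affine_eq ((c2.eventually h).mono fun s hs => hs.2.1)
  exact ⟨e1, e2, e3, e4, eq_of_eventually_linear_eq ((c3.eventually h).mono fun s hs => hs.2.2)⟩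

theorem isSmoothTransformation_of_eqOn {E : Type*} [NormedAddCommGroup E] [NormedSpace ℝ E]
    [FiniteDimensional ℝ E] {Ω : Set E} {Φ : E → E} (hΩ : IsOpen Ω) (hc : IsConnected Ω)
    {L : E →L[ℝ] E} (hL : Function.Injective L) (c : E) (h : ∀ p ∈ Ω, Φ p = L p + c) :
    IsSmoothTransformation Ω Φ := by
  refine ⟨hΩ, hc, ?_, ?_, ?_⟩
  · exact (L.contDiff.add contDiff_const).contDiffOn.congr h
  · intro p hp q hq hpq
    rw [h p hp, h q hq] at hpq
    exact hL (add_right_cancel hpq)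
  · intro p hp
    have h1 : HasFDerivAt Φ L p := (L.hasFDerivAt.add_const c).congr_of_eventuallyEq
      (Filter.eventually_of_mem (hΩ.mem_nhds hp) h)
    rw [h1.fderiv]
    exact ContinuousLinearMap.isInvertible_of_injective hL

section admissible
variable {e e' : FKdV} {Ω : Set (ℝ × ℝ × ℝ)} {Φ : ℝ × ℝ × ℝ → ℝ × ℝ × ℝ}

/-- The general form of the admissible transformations. -/
theorem IsAdmissible.exists_eq (h : IsAdmissible e e' Ω Φ) : e'.n = e.n ∧
    ∃ δ₁ δ₂ δ₃ δ₄ κ : ℝ, δ₁ ≠ 0 ∧ δ₃ ≠ 0 ∧ κ ^ e.n = δ₁ / δ₃ ∧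
      ∀ P ∈ Ω, Φ P = (δ₃ * P.1 + δ₄, δ₁ * P.2.1 + δ₂, κ * P.2.2) ∧
        e'.β (Φ P).1 = δ₁ ^ 5 / δ₃ * e.β P.1 := by
  have hne := h.1.2.1.nonempty
  refine ⟨(h.pointwise hne.some_mem).1, ?_⟩
  let Q : ℝ × ℝ × ℝ × ℝ × ℝ → ℝ × ℝ × ℝ → Prop := fun d P =>
    d.1 ≠ 0 ∧ d.2.2.1 ≠ 0 ∧ d.2.2.2.2 ^ e.n = d.1 / d.2.2.1 ∧
      Φ P = (d.2.2.1 * P.1 + d.2.2.2.1, d.1 * P.2.1 + d.2.1, d.2.2.2.2 * P.2.2) ∧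
      e'.β (Φ P).1 = d.1 ^ 5 / d.2.2.1 * e.β P.1
  have hex : ∀ p ∈ Ω, ∃ d, ∀ᶠ P in 𝓝 p, Q d P := by
    intro p hp
    obtain ⟨δ₁, δ₂, δ₃, δ₄, κ, h1, h3, hκ, hP⟩ := h.eventually_eq hp
    exact ⟨(δ₁, δ₂, δ₃, δ₄, κ), hP.mono fun P hP => ⟨h1, h3, hκ, hP⟩⟩
  have huniq : ∀ d d' p, (∀ᶠ P in 𝓝 p, Q d P) → (∀ᶠ P in 𝓝 p, Q d' P) → d = d' := by
    rintro ⟨a₁, a₂, a₃, a₄, k⟩ ⟨b₁, b₂, b₃, b₄, l⟩ p hi hj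
    obtain ⟨e1, e2, e3, e4, e5⟩ := eq_of_eventually_affineTriple_eq
      ((hi.and hj).mono fun P hP => hP.1.2.2.2.1.symm.trans hP.2.2.2.2.1)
    simp only at e1 e2 e3 e4 e5
    rw [e1, e2, e3, e4, e5]
  obtain ⟨⟨δ₁, δ₂, δ₃, δ₄, κ⟩, hd⟩ :=
    h.1.2.1.isPreconnected.exists_forall_of_eventually hne Q hex huniq
  obtain ⟨h1, h3, hκ, -⟩ := hd _ hne.some_mem
  exact ⟨δ₁, δ₂, δ₃, δ₄, κ, h1, h3, hκ, fun P hP => (hd P hP).2.2.2⟩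

/-- With `ξ = 0`, `a = δ₁` and `U = κ u`, the relation for `κ ^ n` turns the pulled-back equation
into `κ` times the source equation. -/
theorem isAdmissible_of_eq (hΩ : IsOpen Ω) (hc : IsConnected Ω) (hn : e'.n = e.n)
    (hI : ∀ p ∈ Ω, p.1 ∈ e.I ∧ (Φ p).1 ∈ e'.I) {δ₁ δ₂ δ₃ δ₄ κ : ℝ} (h₁ : δ₁ ≠ 0) (h₃ : δ₃ ≠ 0)
    (hκ : κ ^ e.n = δ₁ / δ₃)
    (hΦ : ∀ P ∈ Ω, Φ P = (δ₃ * P.1 + δ₄, δ₁ * P.2.1 + δ₂, κ * P.2.2))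
    (hβ : ∀ P ∈ Ω, e'.β (Φ P).1 = δ₁ ^ 5 / δ₃ * e.β P.1) : IsAdmissible e e' Ω Φ := by
  have hκ0 : κ ≠ 0 := by
    rintro rfl
    rw [zero_pow (by have := e.two_le_n; omega)] at hκ
    exact div_ne_zero h₁ h₃ hκ.symm
  let L : ℝ × ℝ × ℝ →L[ℝ] ℝ × ℝ × ℝ := (δ₃ • ContinuousLinearMap.fst ℝ ℝ (ℝ × ℝ)).prod
    ((δ₁ • (ContinuousLinearMap.fst ℝ ℝ ℝ).comp (ContinuousLinearMap.snd ℝ ℝ (ℝ × ℝ))).prod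
      (κ • (ContinuousLinearMap.snd ℝ ℝ ℝ).comp (ContinuousLinearMap.snd ℝ ℝ (ℝ × ℝ))))
  have hL : ∀ P, L P = (δ₃ * P.1, δ₁ * P.2.1, κ * P.2.2) := fun P => rfl
  have hLi : Function.Injective L := by
    rintro ⟨t, x, u⟩ ⟨t', x', u'⟩ hP
    simpa [hL, h₁, h₃, hκ0] using hP
  have hΦL : ∀ P ∈ Ω, Φ P = L P + (δ₄, δ₂, 0) := fun P hP => by rw [hΦ P hP, hL]; simp
  refine ⟨isSmoothTransformation_of_eqOn hΩ hc hLi _ hΦL, hI, ?_⟩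
  intro u v hu hv q hq ht
  have hev := Filter.eventually_of_mem (hΩ.mem_nhds hq) hΦ
  have hd : HasFDerivAt Φ L (q.1, q.2, u q) :=
    (L.hasFDerivAt.add_const (δ₄, δ₂, 0)).congr_of_eventuallyEq
      (Filter.eventually_of_mem (hΩ.mem_nhds hq) hΦL)
  rw [holdsAt_transform_iff (τ := δ₃) (ξ := 0) (a := δ₁) hd.differentiableAt
    (by rw [hd.fderiv, hL]; simp) (by rw [hd.fderiv, hL]; simp) (by rw [hd.fderiv, hL]; simp)
    (by rw [hd.fderiv, hL]; simp) h₃ h₁ (by rw [hβ _ hq]; field_simp) ?_ hu hv ht]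
  · have hgc : Continuous fun r : ℝ × ℝ => (r.1, r.2, u r) :=
      continuous_fst.prodMk (continuous_snd.prodMk hu.continuous)
    have hU : ∀ᶠ r : ℝ × ℝ in 𝓝 q, (Φ (r.1, r.2, u r)).2.2 = κ * u r := by
      filter_upwards [hgc.continuousAt.eventually hev] with r hr
      rw [hr]
    have hUx := (tendsto_mk_left q).eventually hU
    have hUt := (tendsto_mk_right q).eventually hU
    rw [Filter.EventuallyEq.deriv_eq hUt, Filter.EventuallyEq.deriv_eq hUx,
      Filter.EventuallyEq.iteratedDeriv_eq 5 hUx, iteratedDeriv_const_mul_field,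
      deriv_const_mul_field, deriv_const_mul_field, hΦ _ hq, hn, FKdV.HoldsAt, mul_pow, hκ]
    set A := deriv (fun s => u (s, q.2)) q.1
    set B := deriv (fun y => u (q.1, y)) q.2
    set C := iteratedDeriv 5 (fun y => u (q.1, y)) q.2
    rw [show κ * A + (δ₃ * (δ₁ / δ₃ * u q ^ e.n) - 0) / δ₁ * (κ * B) + e.β q.1 * (κ * C)
      = κ * (A + u q ^ e.n * B + e.β q.1 * C) by field_simp; ring, mul_eq_zero, or_iff_right hκ0]
  · filter_upwards [hev] with P hP hP1
    rw [hP, hΦ _ hq, hP1]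
    exact ⟨rfl, by ring⟩

end admissible

/-! ### Admissible transformations in terms of the group -/

/-- The element of the group with the given parameters. -/
theorem exists_mem_groupG {n : ℕ} (hn : 2 ≤ n) {δ₁ δ₃ κ : ℝ} (δ₂ δ₄ : ℝ) (h₁ : δ₁ ≠ 0)
    (h₃ : δ₃ ≠ 0) (hκ : κ ^ n = δ₁ / δ₃) : ∃ g ∈ groupG n, ∀ t x u b : ℝ,
      g (t, x, u, b) = (δ₃ * t + δ₄, δ₁ * x + δ₂, κ * u, δ₁ ^ 5 / δ₃ * b) := by
  have hκ0 : κ ≠ 0 := by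
    rintro rfl
    rw [zero_pow (by omega)] at hκ
    exact div_ne_zero h₁ h₃ hκ.symm
  have hb : δ₁ ^ 5 / δ₃ ≠ 0 := div_ne_zero (pow_ne_zero _ h₁) h₃
  let f : ℝ × ℝ × ℝ × ℝ → ℝ × ℝ × ℝ × ℝ :=
    fun p => (δ₃ * p.1 + δ₄, δ₁ * p.2.1 + δ₂, κ * p.2.2.1, δ₁ ^ 5 / δ₃ * p.2.2.2)
  have hf : Function.Bijective f := by
    constructor
    · rintro ⟨t, x, u, b⟩ ⟨t', x', u', b'⟩ h
      simpa [f, h₁, h₃, hκ0] using h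
    · rintro ⟨t, x, u, b⟩
      refine ⟨((t - δ₄) / δ₃, (x - δ₂) / δ₁, u / κ, b / (δ₁ ^ 5 / δ₃)), ?_⟩
      simp only [f, mul_div_cancel₀ _ h₁, mul_div_cancel₀ _ h₃, mul_div_cancel₀ _ hκ0,
        mul_div_cancel₀ _ hb, sub_add_cancel]
  exact ⟨Equiv.ofBijective f hf, ⟨δ₁, δ₂, δ₃, δ₄, κ, h₁, h₃, hκ, fun t x u b => rfl⟩,
    fun t x u b => rfl⟩

theorem isAdmissible_iff (e e' : FKdV) (Ω : Set (ℝ × ℝ × ℝ)) (Φ : ℝ × ℝ × ℝ → ℝ × ℝ × ℝ)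
    (hΩ : IsOpen Ω) (hc : IsConnected Ω) (hI : ∀ p ∈ Ω, p.1 ∈ e.I) :
    IsAdmissible e e' Ω Φ ↔
      e'.n = e.n ∧ (∀ p ∈ Ω, (Φ p).1 ∈ e'.I) ∧ ∃ g ∈ groupG e.n, ∀ p ∈ Ω,
        ((Φ p).1, (Φ p).2.1, (Φ p).2.2, e'.β (Φ p).1) = g (p.1, p.2.1, p.2.2, e.β p.1) := by
  constructor
  · intro h
    obtain ⟨hn, δ₁, δ₂, δ₃, δ₄, κ, h₁, h₃, hκ, hP⟩ := h.exists_eq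
    obtain ⟨g, hg, hgP⟩ := exists_mem_groupG e.two_le_n δ₂ δ₄ h₁ h₃ hκ
    refine ⟨hn, fun p hp => (h.2.1 p hp).2, g, hg, fun p hp => ?_⟩
    rw [hgP, (hP p hp).2, (hP p hp).1]
  · rintro ⟨hn, hI', g, ⟨δ₁, δ₂, δ₃, δ₄, κ, h₁, h₃, hκ, hg⟩, hgP⟩
    simp only [hg, Prod.mk.injEq] at hgP
    exact isAdmissible_of_eq hΩ hc hn (fun p hp => ⟨hI p hp, hI' p hp⟩) h₁ h₃ hκ
      (fun P hP => Prod.ext (hgP P hP).1 (Prod.ext (hgP P hP).2.1 (hgP P hP).2.2.1))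
      (fun P hP => (hgP P hP).2.2.2)

/-! ### The generalized equivalence group -/

/-- The equation with exponent `n` and the given coefficient. -/
def FKdV.ofCoeff (n : ℕ) (hn : 2 ≤ n) (I : Set ℝ) (hI : IsOpen I) (hc : IsConnected I) (β : ℝ → ℝ)
    (hβ : ContDiff ℝ ∞ β) (h0 : ∀ t ∈ I, β t ≠ 0) : FKdV :=
  ⟨n, hn, I, hI, hc, β, hβ.contDiffOn, h0⟩

theorem mem_ball_snoc {t x u b ε : ℝ} {P : ℝ × ℝ × ℝ} {c : ℝ}
    (hP : P ∈ Metric.ball ((t, x, u) : ℝ × ℝ × ℝ) ε) (hc : c ∈ Metric.ball b ε) :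
    (P.1, P.2.1, P.2.2, c) ∈ Metric.ball ((t, x, u, b) : ℝ × ℝ × ℝ × ℝ) ε := by
  simp only [Metric.mem_ball, Prod.dist_eq, max_lt_iff] at hP hc ⊢
  exact ⟨hP.1, hP.2.1, hP.2.2, hc⟩

section equivalence
variable {n n' : ℕ} {Ω : Set (ℝ × ℝ × ℝ × ℝ)} {Ψ : ℝ × ℝ × ℝ × ℝ → ℝ × ℝ × ℝ × ℝ}

theorem IsEquivalenceTransformation.exists_eq_of_coeff (h : IsEquivalenceTransformation n n' Ω Ψ)
    (e : FKdV) (he : e.n = n) {W : Set (ℝ × ℝ × ℝ)} (hW : IsOpen W) (hWc : IsConnected W)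
    (hWΩ : ∀ p ∈ W, p.1 ∈ e.I ∧ (p.1, p.2.1, p.2.2, e.β p.1) ∈ Ω) :
    n' = n ∧ ∃ δ₁ δ₂ δ₃ δ₄ κ : ℝ, δ₁ ≠ 0 ∧ δ₃ ≠ 0 ∧ κ ^ n = δ₁ / δ₃ ∧
      ∀ P ∈ W, Ψ (P.1, P.2.1, P.2.2, e.β P.1)
        = (δ₃ * P.1 + δ₄, δ₁ * P.2.1 + δ₂, κ * P.2.2, δ₁ ^ 5 / δ₃ * e.β P.1) := by
  obtain ⟨e', he', hadm, hβ⟩ := h.2 e he W hW hWc hWΩ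
  obtain ⟨hn, δ₁, δ₂, δ₃, δ₄, κ, h₁, h₃, hκ, hP⟩ := hadm.exists_eq
  refine ⟨by rw [← he', hn, he], δ₁, δ₂, δ₃, δ₄, κ, h₁, h₃, he ▸ hκ, fun P hPW => ?_⟩
  obtain ⟨h4, h5⟩ := hP P hPW
  rw [hβ P hPW] at h5
  simp only [inducedMap, Prod.mk.injEq] at h4
  exact Prod.ext h4.1 (Prod.ext h4.2.1 (Prod.ext h4.2.2 h5))

theorem IsEquivalenceTransformation.eventually_eq (hn : 2 ≤ n)
    (h : IsEquivalenceTransformation n n' Ω Ψ) (hΩ0 : ∀ p ∈ Ω, p.2.2.2 ≠ 0) {p : ℝ × ℝ × ℝ × ℝ}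
    (hp : p ∈ Ω) : n' = n ∧ ∃ δ₁ δ₂ δ₃ δ₄ κ : ℝ, δ₁ ≠ 0 ∧ δ₃ ≠ 0 ∧ κ ^ n = δ₁ / δ₃ ∧
      ∀ᶠ P in 𝓝 p, Ψ P
        = (δ₃ * P.1 + δ₄, δ₁ * P.2.1 + δ₂, κ * P.2.2.1, δ₁ ^ 5 / δ₃ * P.2.2.2) := by
  obtain ⟨ε, hε, hK⟩ := Metric.isOpen_iff.1 h.1.1 p hp
  obtain ⟨t, x, u, b⟩ := p
  set W := Metric.ball ((t, x, u) : ℝ × ℝ × ℝ) ε with hWd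
  have hWo : IsOpen W := Metric.isOpen_ball
  have hWc : IsConnected W := (convex_ball _ _).isConnected (Metric.nonempty_ball.2 hε)
  have hW1 : ∀ P ∈ W, P.1 ∈ Metric.ball t ε := fun P hP => by
    simp only [hWd, Metric.mem_ball, Prod.dist_eq, max_lt_iff] at hP ⊢
    exact hP.1
  have hmove : ∀ s ∈ Metric.ball t ε, b + (s - t) ∈ Metric.ball b ε := fun s hs => by
    simpa [Metric.mem_ball, Real.dist_eq] using hs
  have hne : ∀ c ∈ Metric.ball b ε, c ≠ 0 := fun c hc =>
    hΩ0 _ (hK (mem_ball_snoc (P := (t, x, u)) (Metric.mem_ball_self hε) hc))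
  -- The coefficient `b + (s - t)` takes each value `c` near `b`, at the time `t + (c - b)`. There
  -- its graph meets that of the constant coefficient `c`, and the two sets of parameters can be
  -- compared.
  obtain ⟨hnn, δ₁, δ₂, δ₃, δ₄, κ, h₁, h₃, hκ, hP⟩ := h.exists_eq_of_coeff
    (FKdV.ofCoeff n hn (Metric.ball t ε) Metric.isOpen_ball
      ((convex_ball _ _).isConnected (Metric.nonempty_ball.2 hε)) (fun s => b + (s - t))
      (by fun_prop) fun s hs => hne _ (hmove s hs)) rfl hWo hWc
    fun P hP => ⟨hW1 P hP, hK (mem_ball_snoc hP (hmove _ (hW1 P hP)))⟩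
  refine ⟨hnn, δ₁, δ₂, δ₃, δ₄, κ, h₁, h₃, hκ, ?_⟩
  filter_upwards [Metric.ball_mem_nhds ((t, x, u, b) : ℝ × ℝ × ℝ × ℝ) hε] with ⟨s, y, z, c⟩ hZ
  simp only [Metric.mem_ball, Prod.dist_eq, max_lt_iff] at hZ
  have hc : c ∈ Metric.ball b ε := hZ.2.2.2
  obtain ⟨-, a₁, a₂, a₃, a₄, k, g₁, g₃, hk, hQ⟩ := h.exists_eq_of_coeff
    (FKdV.ofCoeff n hn Set.univ isOpen_univ isConnected_univ (fun _ => c)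
      contDiff_const fun _ _ => hne c hc) rfl hWo hWc
    fun P hP => ⟨Set.mem_univ _, hK (mem_ball_snoc hP hc)⟩
  have hr : t + (c - b) ∈ Metric.ball t ε := by
    simpa [Metric.mem_ball, Real.dist_eq] using hc
  have hcomp : ∀ x' ∈ Metric.ball x ε, ∀ u' ∈ Metric.ball u ε,
      ((a₃ * (t + (c - b)) + a₄, a₁ * x' + a₂, k * u', a₁ ^ 5 / a₃ * c) : ℝ × ℝ × ℝ × ℝ)
        = (δ₃ * (t + (c - b)) + δ₄, δ₁ * x' + δ₂, κ * u', δ₁ ^ 5 / δ₃ * c) := by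
    intro x' hx' u' hu'
    have hm : (t + (c - b), x', u') ∈ W := by
      simp only [hWd, Metric.mem_ball, Prod.dist_eq, max_lt_iff] at hr hx' hu' ⊢
      exact ⟨hr, hx', hu'⟩
    have q1 := hP _ hm
    have q2 := hQ _ hm
    simp only [FKdV.ofCoeff] at q1 q2
    rw [show b + (t + (c - b) - t) = c by ring] at q1
    exact q2.symm.trans q1
  simp only [Prod.mk.injEq] at hcomp
  have hx0 := Metric.mem_ball_self (x := x) hε
  have hu0 := Metric.mem_ball_self (x := u) hε
  obtain ⟨e1, e2⟩ := eq_of_eventually_affine_eq (Filter.eventually_of_mem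
    (Metric.ball_mem_nhds x hε) fun x' hx' => (hcomp x' hx' u hu0).2.1)
  have e5 := eq_of_eventually_linear_eq (Filter.eventually_of_mem
    (Metric.ball_mem_nhds u hε) fun u' hu' => (hcomp x hx0 u' hu').2.2.1)
  -- The graphs meet at a single time, so the slope in `t` cannot be compared directly; it is
  -- recovered from `κ ^ n = δ₁ / δ₃`.
  have e3 : a₃ = δ₃ := by
    rw [e5, hκ, e1, div_eq_div_iff h₃ g₃] at hk
    exact mul_left_cancel₀ h₁ hk
  have e4 : a₄ = δ₄ := by
    have := (hcomp x hx0 u hu0).1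
    rw [e3] at this
    exact add_left_cancel this
  have hm : (s, y, z) ∈ W := by
    simp only [hWd, Metric.mem_ball, Prod.dist_eq, max_lt_iff]
    exact ⟨hZ.1, hZ.2.1, hZ.2.2.1⟩
  have := hQ _ hm
  rw [e1, e2, e3, e4, e5] at this
  exact this

theorem IsEquivalenceTransformation.exists_eq (hn : 2 ≤ n)
    (h : IsEquivalenceTransformation n n' Ω Ψ) (hΩ0 : ∀ p ∈ Ω, p.2.2.2 ≠ 0) :
    n' = n ∧ ∃ δ₁ δ₂ δ₃ δ₄ κ : ℝ, δ₁ ≠ 0 ∧ δ₃ ≠ 0 ∧ κ ^ n = δ₁ / δ₃ ∧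
      ∀ P ∈ Ω, Ψ P
        = (δ₃ * P.1 + δ₄, δ₁ * P.2.1 + δ₂, κ * P.2.2.1, δ₁ ^ 5 / δ₃ * P.2.2.2) := by
  have hne := h.1.2.1.nonempty
  refine ⟨(h.eventually_eq hn hΩ0 hne.some_mem).1, ?_⟩
  let Q : ℝ × ℝ × ℝ × ℝ × ℝ → ℝ × ℝ × ℝ × ℝ → Prop := fun d P =>
    d.1 ≠ 0 ∧ d.2.2.1 ≠ 0 ∧ d.2.2.2.2 ^ n = d.1 / d.2.2.1 ∧
      Ψ P = (d.2.2.1 * P.1 + d.2.2.2.1, d.1 * P.2.1 + d.2.1, d.2.2.2.2 * P.2.2.1,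
        d.1 ^ 5 / d.2.2.1 * P.2.2.2)
  have hex : ∀ p ∈ Ω, ∃ d, ∀ᶠ P in 𝓝 p, Q d P := by
    intro p hp
    obtain ⟨-, δ₁, δ₂, δ₃, δ₄, κ, h1, h3, hκ, hP⟩ := h.eventually_eq hn hΩ0 hp
    exact ⟨(δ₁, δ₂, δ₃, δ₄, κ), hP.mono fun P hP => ⟨h1, h3, hκ, hP⟩⟩
  have huniq : ∀ d d' p, (∀ᶠ P in 𝓝 p, Q d P) → (∀ᶠ P in 𝓝 p, Q d' P) → d = d' := by
    rintro ⟨a₁, a₂, a₃, a₄, k⟩ ⟨b₁, b₂, b₃, b₄, l⟩ p hi hj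
    have hc : Filter.Tendsto (fun P : ℝ × ℝ × ℝ => (P.1, P.2.1, P.2.2, p.2.2.2))
        (𝓝 (p.1, p.2.1, p.2.2.1)) (𝓝 p) :=
      (by fun_prop : Continuous fun P : ℝ × ℝ × ℝ => (P.1, P.2.1, P.2.2, p.2.2.2)).tendsto _
    obtain ⟨e1, e2, e3, e4, e5⟩ := eq_of_eventually_affineTriple_eq
      (p := (p.1, p.2.1, p.2.2.1)) ((hc.eventually (hi.and hj)).mono fun P hP => by
        have := hP.1.2.2.2.symm.trans hP.2.2.2.2
        simp only [Prod.mk.injEq] at this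
        exact Prod.ext this.1 (Prod.ext this.2.1 this.2.2.1))
    rw [e1, e2, e3, e4, e5]
  obtain ⟨⟨δ₁, δ₂, δ₃, δ₄, κ⟩, hd⟩ :=
    h.1.2.1.isPreconnected.exists_forall_of_eventually hne Q hex huniq
  obtain ⟨h1, h3, hκ, -⟩ := hd _ hne.some_mem
  exact ⟨δ₁, δ₂, δ₃, δ₄, κ, h1, h3, hκ, fun P hP => (hd P hP).2.2.2⟩

/-- The image of an equation under a transformation of the group. -/
theorem FKdV.exists_transform (e : FKdV) {δ₁ δ₃ : ℝ} (δ₄ : ℝ) (h₁ : δ₁ ≠ 0) (h₃ : δ₃ ≠ 0) :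
    ∃ e' : FKdV, e'.n = e.n ∧ ∀ t ∈ e.I, δ₃ * t + δ₄ ∈ e'.I ∧
      e'.β (δ₃ * t + δ₄) = δ₁ ^ 5 / δ₃ * e.β t := by
  have hinv : ∀ t, (δ₃ * t + δ₄ - δ₄) / δ₃ = t := fun t => by field_simp; ring
  have hinv' : ∀ t, δ₃ * ((t - δ₄) / δ₃) + δ₄ = t := fun t => by field_simp; ring
  have hcont : ContDiff ℝ ∞ fun t : ℝ => (t - δ₄) / δ₃ := by fun_prop
  have himg : (fun t => (t - δ₄) / δ₃) ⁻¹' e.I = (fun t => δ₃ * t + δ₄) '' e.I := by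
    ext t
    constructor
    · exact fun ht => ⟨_, ht, hinv' t⟩
    · rintro ⟨s, hs, rfl⟩
      simpa only [Set.mem_preimage, hinv] using hs
  refine ⟨⟨e.n, e.two_le_n, (fun t => (t - δ₄) / δ₃) ⁻¹' e.I, e.isOpen_I.preimage hcont.continuous,
    ?_, fun t => δ₁ ^ 5 / δ₃ * e.β ((t - δ₄) / δ₃), ?_, ?_⟩, rfl, fun t ht => ⟨?_, ?_⟩⟩
  · rw [himg]
    exact e.isConnected_I.image _ (by fun_prop)
  · exact contDiffOn_const.mul (e.smooth_β.comp hcont.contDiffOn fun t ht => ht)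
  · exact fun t ht => mul_ne_zero (div_ne_zero (pow_ne_zero _ h₁) h₃) (e.β_ne_zero _ ht)
  · simpa only [Set.mem_preimage, hinv] using ht
  · simp only [hinv]

theorem isEquivalenceTransformation_of_eq (hn : 2 ≤ n) (hΩ : IsOpen Ω) (hc : IsConnected Ω)
    {δ₁ δ₂ δ₃ δ₄ κ : ℝ} (h₁ : δ₁ ≠ 0) (h₃ : δ₃ ≠ 0) (hκ : κ ^ n = δ₁ / δ₃)
    (hΨ : ∀ P ∈ Ω, Ψ P
      = (δ₃ * P.1 + δ₄, δ₁ * P.2.1 + δ₂, κ * P.2.2.1, δ₁ ^ 5 / δ₃ * P.2.2.2)) :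
    IsEquivalenceTransformation n n Ω Ψ := by
  have hκ0 : κ ≠ 0 := by
    rintro rfl
    rw [zero_pow (by omega)] at hκ
    exact div_ne_zero h₁ h₃ hκ.symm
  let F := ContinuousLinearMap.fst ℝ ℝ (ℝ × ℝ × ℝ)
  let S := ContinuousLinearMap.snd ℝ ℝ (ℝ × ℝ × ℝ)
  let L : ℝ × ℝ × ℝ × ℝ →L[ℝ] ℝ × ℝ × ℝ × ℝ := (δ₃ • F).prod
    ((δ₁ • (ContinuousLinearMap.fst ℝ ℝ (ℝ × ℝ)).comp S).prod
      ((κ • ((ContinuousLinearMap.fst ℝ ℝ ℝ).comp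
        ((ContinuousLinearMap.snd ℝ ℝ (ℝ × ℝ)).comp S))).prod
        ((δ₁ ^ 5 / δ₃) • ((ContinuousLinearMap.snd ℝ ℝ ℝ).comp
          ((ContinuousLinearMap.snd ℝ ℝ (ℝ × ℝ)).comp S)))))
  have hL : ∀ P, L P = (δ₃ * P.1, δ₁ * P.2.1, κ * P.2.2.1, δ₁ ^ 5 / δ₃ * P.2.2.2) := fun P => rfl
  have hLi : Function.Injective L := by
    rintro ⟨t, x, u, b⟩ ⟨t', x', u', b'⟩ hP
    simpa [hL, h₁, h₃, hκ0] using hP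
  refine ⟨isSmoothTransformation_of_eqOn hΩ hc hLi (δ₄, δ₂, 0, 0)
    fun P hP => by rw [hΨ P hP, hL]; simp, ?_⟩
  rintro e rfl W hW hWc hWΩ
  obtain ⟨e', hn', he'⟩ := e.exists_transform δ₄ h₁ h₃
  have hind : ∀ P ∈ W, inducedMap Ψ e.β P = (δ₃ * P.1 + δ₄, δ₁ * P.2.1 + δ₂, κ * P.2.2) :=
    fun P hP => by simp only [inducedMap, hΨ _ (hWΩ P hP).2]
  refine ⟨e', hn', isAdmissible_of_eq hW hWc hn' (fun P hP => ⟨(hWΩ P hP).1, ?_⟩) h₁ h₃ hκ hind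
    fun P hP => ?_, fun P hP => ?_⟩
  · rw [hind P hP]; exact (he' _ (hWΩ P hP).1).1
  · rw [hind P hP]; exact (he' _ (hWΩ P hP).1).2
  · rw [hind P hP, hΨ _ (hWΩ P hP).2]; exact (he' _ (hWΩ P hP).1).2

theorem isEquivalenceTransformation_iff (hn : 2 ≤ n) (hΩ : IsOpen Ω) (hc : IsConnected Ω)
    (hΩ0 : ∀ p ∈ Ω, p.2.2.2 ≠ 0) :
    IsEquivalenceTransformation n n' Ω Ψ ↔ n' = n ∧ ∃ g ∈ groupG n, Set.EqOn Ψ g Ω := by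
  constructor
  · intro h
    obtain ⟨hnn, δ₁, δ₂, δ₃, δ₄, κ, h₁, h₃, hκ, hP⟩ := h.exists_eq hn hΩ0
    obtain ⟨g, hg, hgP⟩ := exists_mem_groupG hn δ₂ δ₄ h₁ h₃ hκ
    exact ⟨hnn, g, hg, fun P hPΩ => (hP P hPΩ).trans (hgP P.1 P.2.1 P.2.2.1 P.2.2.2).symm⟩
  · rintro ⟨rfl, g, ⟨δ₁, δ₂, δ₃, δ₄, κ, h₁, h₃, hκ, hg⟩, hΨ⟩
    exact isEquivalenceTransformation_of_eq hn hΩ hc h₁ h₃ hκ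
      fun P hP => (hΨ hP).trans (hg P.1 P.2.1 P.2.2.1 P.2.2.2)

end equivalence

/-! ### Elements preserving positivity, and the main theorem -/

theorem mem_groupG_and_pos_iff {n : ℕ} (hn : 2 ≤ n) (g : Equiv.Perm (ℝ × ℝ × ℝ × ℝ)) :
    (g ∈ groupG n ∧ ∀ t x u b : ℝ, 0 < u → 0 < (g (t, x, u, b)).2.2.1) ↔
      ∃ δ₁ δ₂ δ₃ δ₄ : ℝ, 0 < δ₁ * δ₃ ∧ ∀ t x u b : ℝ, g (t, x, u, b) =
        (δ₃ * t + δ₄, δ₁ * x + δ₂, (δ₁ / δ₃) ^ ((1 : ℝ) / n) * u, δ₁ ^ 5 / δ₃ * b) := by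
  have hn0 : n ≠ 0 := by omega
  constructor
  · rintro ⟨⟨δ₁, δ₂, δ₃, δ₄, κ, h₁, h₃, hκ, hg⟩, hpos⟩
    have hκ0 : 0 < κ := by simpa [hg] using hpos 0 0 1 0 one_pos
    have hdiv : 0 < δ₁ / δ₃ := hκ ▸ pow_pos hκ0 n
    refine ⟨δ₁, δ₂, δ₃, δ₄, ?_, fun t x u b => ?_⟩
    · have : δ₁ * δ₃ = δ₁ / δ₃ * δ₃ ^ 2 := by field_simp
      rw [this]
      positivity
    · rw [hg, ← hκ, one_div, Real.pow_rpow_inv_natCast hκ0.le hn0]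
  · rintro ⟨δ₁, δ₂, δ₃, δ₄, h, hg⟩
    have h₁ : δ₁ ≠ 0 := left_ne_zero_of_mul h.ne'
    have h₃ : δ₃ ≠ 0 := right_ne_zero_of_mul h.ne'
    have hdiv : 0 < δ₁ / δ₃ := by
      have : δ₁ / δ₃ = δ₁ * δ₃ / δ₃ ^ 2 := by field_simp
      rw [this]
      positivity
    refine ⟨⟨δ₁, δ₂, δ₃, δ₄, _, h₁, h₃, ?_, hg⟩, fun t x u b hu => ?_⟩
    · rw [one_div, Real.rpow_inv_natCast_pow hdiv.le hn0]
    · rw [hg]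
      exact mul_pos (Real.rpow_pos_of_pos hdiv _) hu

theorem mainTheorem3 :
    -- the generalized equivalence group
    (∀ n : ℕ, 2 ≤ n → ∀ (n' : ℕ) (Ω : Set (ℝ × ℝ × ℝ × ℝ))
      (Ψ : ℝ × ℝ × ℝ × ℝ → ℝ × ℝ × ℝ × ℝ),
      IsOpen Ω → IsConnected Ω → (∀ p ∈ Ω, p.2.2.2 ≠ 0) →
      (IsEquivalenceTransformation n n' Ω Ψ ↔
        n' = n ∧ ∃ g ∈ groupG n, Set.EqOn Ψ g Ω)) ∧
    -- the admissible transformations are generated by this group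
    (∀ (e e' : FKdV) (Ω : Set (ℝ × ℝ × ℝ)) (Φ : ℝ × ℝ × ℝ → ℝ × ℝ × ℝ),
      IsOpen Ω → IsConnected Ω → (∀ p ∈ Ω, p.1 ∈ e.I) →
      (IsAdmissible e e' Ω Φ ↔
        e'.n = e.n ∧ (∀ p ∈ Ω, (Φ p).1 ∈ e'.I) ∧ ∃ g ∈ groupG e.n, ∀ p ∈ Ω,
          ((Φ p).1, (Φ p).2.1, (Φ p).2.2, e'.β (Φ p).1) =
            g (p.1, p.2.1, p.2.2, e.β p.1))) ∧
    -- the elements that preserve the sign of the dependent variable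
    (∀ n : ℕ, 2 ≤ n → ∀ g : Equiv.Perm (ℝ × ℝ × ℝ × ℝ),
      ((g ∈ groupG n ∧ ∀ t x u b : ℝ, 0 < u → 0 < (g (t, x, u, b)).2.2.1) ↔
        ∃ δ₁ δ₂ δ₃ δ₄ : ℝ, 0 < δ₁ * δ₃ ∧ ∀ t x u b : ℝ, g (t, x, u, b) =
          (δ₃ * t + δ₄, δ₁ * x + δ₂, (δ₁ / δ₃) ^ ((1 : ℝ) / n) * u, δ₁ ^ 5 / δ₃ * b))) :=
  ⟨fun _ hn _ _ _ hΩ hc h0 => isEquivalenceTransformation_iff hn hΩ hc h0,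
    isAdmissible_iff, fun _ hn g => mem_groupG_and_pos_iff hn g⟩
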